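/- Let $V$ be a complex vector space of finite dimension $r$, let $G\subset\mathrm{GL}(V)$ be a complex reflection group (a finite group generated by reflections, a reflection being an element of finite order that fixes some hyperplane pointwise), let $N\trianglelefteq G$ be a normal subgroup that is also generated by reflections, and put $H=G/N$. Let $S(V^*)$ be the graded algebra of polynomials on $V$. There are homogeneous, algebraically independent polynomials $N_1,\dots,N_r$ that generate the invariant algebra $S(V^*)^N$ and whose span $E^*=\mathrm{span}_{\mathbb C}\{N_1,\dots,N_r\}$ is $G$-stable. Fix any such choice. Then $H$ acts on $E^*$, and $S(E^*)$ is identified with $S(V^*)^N$; it is graded by the degree inherited from $S(V^*)$ (so that $N_i$ has its degree as a polynomial on $V$). For a finite group $K$ acting linearly on a finite-dimensional complex vector space $W$, call $f\in S(W^*)$ $K$-harmonic if $p(\partial)f=0$ for every $K$-invariant constant coefficient differential operator $p(\partial)$, $p\in S(W)^K$, without constant term. Let $\mathcal C_G,\mathcal C_N\subset S(V^*)$ and $\mathcal C_H\subset S(E^*)$ be the spaces of $G$-, $N$- and $H$-harmonic polynomials, where $W=V$ for $G$ and $N$, and $W=E$ (the dual of $E^*$) for $H$. All three are graded by the degree of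 $S(V^*)$; $\mathcal C_G$ and $\mathcal C_N$ are $G$-modules, and $\mathcal C_H$ is an $H$-module, hence a $G$-module on which $N$ acts trivially. **Proposition.** There is an isomorphism of graded $G$-modules $\varphi:\mathcal C_H\otimes\mathcal C_N\to\mathcal C_G$, and $c\mapsto\varphi(c\otimes 1)$ is an isomorphism of graded $H$-modules from $\mathcal C_H$ onto the space of $N$-invariants $(\mathcal C_G)^N$. -/

import Mathlib

open scoped TensorProduct

namespace HarmonicPoly

/-! ### Polynomial functions, differential operators, harmonic polynomials -/

section General

variable {U : Type*} [AddCommGroup U] [Module ℂ U] {K : Type*} [Group K]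

/-- The degree `d` homogeneous part of the symmetric algebra `S(U)`: the span of all products
of `d` elements of `U`. -/
noncomputable def homogeneousPart (U : Type*) [AddCommGroup U] [Module ℂ U] (d : ℕ) :
    Submodule ℂ (SymmetricAlgebra ℂ U) :=
  LinearMap.range (SymmetricAlgebra.ι ℂ U) ^ d

/-- The action of a group on `S(U)` by algebra automorphisms that extends its linear action `ρ`
on `U`. -/
noncomputable def symRep (ρ : Representation ℂ K U) :
    Representation ℂ K (SymmetricAlgebra ℂ U) where
  toFun g := (SymmetricAlgebra.lift (SymmetricAlgebra.ι ℂ U ∘ₗ ρ g)).toLinearMap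
  map_one' := by
    have : SymmetricAlgebra.lift (SymmetricAlgebra.ι ℂ U ∘ₗ ρ 1) =
        AlgHom.id ℂ (SymmetricAlgebra ℂ U) := by
      ext u; simp
    rw [this]; rfl
  map_mul' g h := by
    have : SymmetricAlgebra.lift (SymmetricAlgebra.ι ℂ U ∘ₗ ρ (g * h)) =
        (SymmetricAlgebra.lift (SymmetricAlgebra.ι ℂ U ∘ₗ ρ g)).comp
          (SymmetricAlgebra.lift (SymmetricAlgebra.ι ℂ U ∘ₗ ρ h)) := by
      ext u; simp
    rw [this]; rfl

@[simp] theorem symRep_ι (ρ : Representation ℂ K U) (g : K) (u : U) :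
    symRep ρ g (SymmetricAlgebra.ι ℂ U u) = SymmetricAlgebra.ι ℂ U (ρ g u) := by
  simp [symRep]

@[simp] theorem symRep_one (ρ : Representation ℂ K U) (g : K) : symRep ρ g 1 = 1 := by
  simp [symRep]

@[simp] theorem symRep_algebraMap (ρ : Representation ℂ K U) (g : K) (c : ℂ) :
    symRep ρ g (algebraMap ℂ _ c) = algebraMap ℂ _ c := by
  simp [symRep]

@[simp] theorem symRep_mul (ρ : Representation ℂ K U) (g : K) (a b : SymmetricAlgebra ℂ U) :
    symRep ρ g (a * b) = symRep ρ g a * symRep ρ g b := by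
  simp [symRep]

/-- The algebra homomorphism `S(U) → S(U)[ε]` with `u ↦ u + ξ(u) ε`. -/
noncomputable def taylorHom (ξ : Module.Dual ℂ U) :
    SymmetricAlgebra ℂ U →ₐ[ℂ] DualNumber (SymmetricAlgebra ℂ U) :=
  SymmetricAlgebra.lift
    ((TrivSqZeroExt.inlAlgHom ℂ (SymmetricAlgebra ℂ U) (SymmetricAlgebra ℂ U)).toLinearMap ∘ₗ
        SymmetricAlgebra.ι ℂ U +
      (TrivSqZeroExt.inrHom (SymmetricAlgebra ℂ U) (SymmetricAlgebra ℂ U)).restrictScalars ℂ ∘ₗ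
        Algebra.linearMap ℂ (SymmetricAlgebra ℂ U) ∘ₗ ξ)

theorem fst_taylorHom (ξ : Module.Dual ℂ U) (f : SymmetricAlgebra ℂ U) :
    (taylorHom ξ f).fst = f := by
  have : (TrivSqZeroExt.fstHom ℂ (SymmetricAlgebra ℂ U) (SymmetricAlgebra ℂ U)).comp
      (taylorHom ξ) = AlgHom.id ℂ _ := by
    ext u; simp [taylorHom]
  exact DFunLike.congr_fun this f

/-- The directional derivative `∂_ξ` on `S(U)`, for `ξ` in the dual of `U`: the derivation
of `S(U)` with `∂_ξ u = ξ(u)` for `u` in `U`. -/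
noncomputable def dirDeriv (ξ : Module.Dual ℂ U) :
    Derivation ℂ (SymmetricAlgebra ℂ U) (SymmetricAlgebra ℂ U) :=
  Derivation.mk'
    ((TrivSqZeroExt.sndHom (SymmetricAlgebra ℂ U) (SymmetricAlgebra ℂ U)).restrictScalars ℂ ∘ₗ
      (taylorHom ξ).toLinearMap)
    (fun a b => by simp [fst_taylorHom, mul_comm])

@[simp] theorem dirDeriv_ι (ξ : Module.Dual ℂ U) (u : U) :
    dirDeriv ξ (SymmetricAlgebra.ι ℂ U u) = algebraMap ℂ _ (ξ u) := by
  simp [dirDeriv, taylorHom, Algebra.algebraMap_eq_smul_one]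

theorem derivation_ext {D₁ D₂ : Derivation ℂ (SymmetricAlgebra ℂ U) (SymmetricAlgebra ℂ U)}
    (h : ∀ u, D₁ (SymmetricAlgebra.ι ℂ U u) = D₂ (SymmetricAlgebra.ι ℂ U u)) : D₁ = D₂ := by
  ext f
  induction f using SymmetricAlgebra.induction with
  | algebraMap c => simp
  | ι u => exact h u
  | mul a b ha hb => simp [ha, hb]
  | add a b ha hb => simp [ha, hb]

theorem dirDeriv_comm (ξ η : Module.Dual ℂ U) (f : SymmetricAlgebra ℂ U) :
    dirDeriv ξ (dirDeriv η f) = dirDeriv η (dirDeriv ξ f) := by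
  have h : ⁅dirDeriv ξ, dirDeriv η⁆ = 0 := by
    apply derivation_ext; intro u; simp [Derivation.commutator_apply]
  have := DFunLike.congr_fun h f
  rwa [Derivation.commutator_apply, Derivation.zero_apply, sub_eq_zero] at this

/-- The directional derivative, as a linear function of the direction. -/
noncomputable def dirDerivHom :
    Module.Dual ℂ U →ₗ[ℂ] Module.End ℂ (SymmetricAlgebra ℂ U) where
  toFun ξ := (dirDeriv ξ : SymmetricAlgebra ℂ U →ₗ[ℂ] SymmetricAlgebra ℂ U)
  map_add' ξ η := by
    have : dirDeriv (ξ + η) = dirDeriv ξ + dirDeriv η := by apply derivation_ext; simp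
    rw [this]; rfl
  map_smul' c ξ := by
    have : dirDeriv (c • ξ) = c • dirDeriv ξ := by
      apply derivation_ext; simp [Algebra.smul_def]
    rw [this]; rfl

/-- The algebra of operators on `S(U)` that is generated by the directional derivatives. -/
noncomputable abbrev diffOpAlgebra (U : Type*) [AddCommGroup U] [Module ℂ U] :
    Subalgebra ℂ (Module.End ℂ (SymmetricAlgebra ℂ U)) :=
  Algebra.adjoin ℂ (Set.range (dirDerivHom (U := U)))

noncomputable instance : CommRing (diffOpAlgebra U) :=
  { (inferInstance : Ring (diffOpAlgebra U)) with
    mul_comm := (Algebra.isMulCommutative_adjoin ℂ (s := Set.range (dirDerivHom (U := U))) (by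
      rintro _ ⟨ξ, rfl⟩ _ ⟨η, rfl⟩
      exact LinearMap.ext (dirDeriv_comm ξ η))).is_comm.comm }

/-- The constant coefficient differential operator `p(∂)` on `S(U)` that is attached to
`p ∈ S(U*)`: the algebra homomorphism `S(U*) → End S(U)` with `ξ ↦ ∂_ξ`. -/
noncomputable def diffOp :
    SymmetricAlgebra ℂ (Module.Dual ℂ U) →ₐ[ℂ] Module.End ℂ (SymmetricAlgebra ℂ U) :=
  (diffOpAlgebra U).val.comp
    (SymmetricAlgebra.lift (A := diffOpAlgebra U)
      (dirDerivHom.codRestrict (Subalgebra.toSubmodule (diffOpAlgebra U))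
        fun ξ => Algebra.subset_adjoin ⟨ξ, rfl⟩))

@[simp] theorem diffOp_ι (ξ : Module.Dual ℂ U) (f : SymmetricAlgebra ℂ U) :
    diffOp (SymmetricAlgebra.ι ℂ _ ξ) f = dirDeriv ξ f := by
  simp only [diffOp, AlgHom.comp_apply, SymmetricAlgebra.lift_ι_apply]
  rfl

theorem diffOp_one_right (p : SymmetricAlgebra ℂ (Module.Dual ℂ U)) :
    diffOp p (1 : SymmetricAlgebra ℂ U) =
      algebraMap ℂ _ (SymmetricAlgebra.algebraMapInv p) := by
  induction p using SymmetricAlgebra.induction with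
  | algebraMap c =>
    rw [AlgHom.commutes, SymmetricAlgebra.algebraMap_leftInverse]
    simp [Module.algebraMap_end_apply, Algebra.smul_def]
  | ι ξ => simp [SymmetricAlgebra.algebraMapInv_ι]
  | mul a b ha hb =>
    rw [map_mul, Module.End.mul_apply, hb, Algebra.algebraMap_eq_smul_one, map_smul, ha]
    simp [Algebra.smul_def, mul_comm]
  | add a b ha hb => simp [ha, hb]

theorem dirDeriv_equivariant (ρ : Representation ℂ K U) (g : K) (ξ : Module.Dual ℂ U)
    (f : SymmetricAlgebra ℂ U) :
    dirDeriv (ρ.dual g ξ) (symRep ρ g f) = symRep ρ g (dirDeriv ξ f) := by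
  induction f using SymmetricAlgebra.induction with
  | algebraMap c => simp
  | ι u => simp [Module.Dual.transpose_apply]
  | mul a b ha hb =>
    rw [symRep_mul, Derivation.leibniz, Derivation.leibniz, ha, hb]; simp
  | add a b ha hb => rw [map_add, map_add, map_add, map_add, ha, hb]

theorem diffOp_equivariant (ρ : Representation ℂ K U) (g : K)
    (p : SymmetricAlgebra ℂ (Module.Dual ℂ U)) (f : SymmetricAlgebra ℂ U) :
    diffOp (symRep ρ.dual g p) (symRep ρ g f) = symRep ρ g (diffOp p f) := by
  induction p using SymmetricAlgebra.induction generalizing f with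
  | algebraMap c => simp [Module.algebraMap_end_apply]
  | ι ξ => rw [symRep_ι, diffOp_ι, diffOp_ι, dirDeriv_equivariant]
  | mul a b ha hb => simp only [symRep_mul, map_mul, Module.End.mul_apply, ha, hb]
  | add a b ha hb => simp only [map_add, LinearMap.add_apply, ha, hb]

theorem algebraMapInv_symRep (ρ : Representation ℂ K U) (g : K) (p : SymmetricAlgebra ℂ U) :
    SymmetricAlgebra.algebraMapInv (symRep ρ g p) = SymmetricAlgebra.algebraMapInv p := by
  induction p using SymmetricAlgebra.induction with
  | algebraMap c => simp
  | ι u => simp [SymmetricAlgebra.algebraMapInv_ι]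
  | mul a b ha hb => simp [ha, hb]
  | add a b ha hb => simp [ha, hb]

/-- The harmonic polynomials in `S(U)` for the action of a subgroup `N` of `K` on `U`: those that
are annihilated by all `N`-invariant constant coefficient differential operators without
constant term. -/
noncomputable def harmonic (ρ : Representation ℂ K U) (N : Subgroup K) :
    Submodule ℂ (SymmetricAlgebra ℂ U) where
  carrier := {f | ∀ p : SymmetricAlgebra ℂ (Module.Dual ℂ U),
    (∀ n ∈ N, symRep ρ.dual n p = p) → SymmetricAlgebra.algebraMapInv p = 0 → diffOp p f = 0}
  zero_mem' := fun p _ _ => map_zero _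
  add_mem' := fun {a b} ha hb p h₁ h₂ => by rw [map_add, ha p h₁ h₂, hb p h₁ h₂, add_zero]
  smul_mem' := fun c f hf p h₁ h₂ => by rw [map_smul, hf p h₁ h₂, smul_zero]

theorem one_mem_harmonic (ρ : Representation ℂ K U) (N : Subgroup K) :
    (1 : SymmetricAlgebra ℂ U) ∈ harmonic ρ N := fun p _ h => by
  rw [diffOp_one_right, h, map_zero]

theorem harmonic_le_comap (ρ : Representation ℂ K U) (N : Subgroup K) [N.Normal] (g : K) :
    harmonic ρ N ≤ (harmonic ρ N).comap (symRep ρ g) := by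
  intro f hf p hp h0
  have key : diffOp (symRep ρ.dual g⁻¹ p) f = 0 := by
    refine hf _ (fun n hn => ?_) (by rw [algebraMapInv_symRep, h0])
    have h := hp (g * n * g⁻¹) (Subgroup.Normal.conj_mem inferInstance n hn g)
    calc symRep ρ.dual n (symRep ρ.dual g⁻¹ p)
        = symRep ρ.dual g⁻¹ (symRep ρ.dual (g * n * g⁻¹) p) := by
          rw [← Module.End.mul_apply, ← Module.End.mul_apply, ← map_mul, ← map_mul]
          congr 2; group
      _ = _ := by rw [h]
  have h := diffOp_equivariant ρ g (symRep ρ.dual g⁻¹ p) f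
  have e : symRep ρ.dual g (symRep ρ.dual g⁻¹ p) = p := by
    rw [← Module.End.mul_apply, ← map_mul, mul_inv_cancel, map_one, Module.End.one_apply]
  rwa [key, map_zero, e] at h

/-- The action of `K` on the harmonic polynomials of a normal subgroup. -/
noncomputable def harmonicRep (ρ : Representation ℂ K U) (N : Subgroup K) [N.Normal] :
    Representation ℂ K (harmonic ρ N) :=
  (symRep ρ).subrepresentation (harmonic ρ N) (harmonic_le_comap ρ N)

end General

/-! ### Reflection groups -/

section Reflection

variable {V : Type*} [AddCommGroup V] [Module ℂ V]

/-- A reflection: an element of finite order of `GL(V)` that fixes some hyperplane pointwise. -/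
def IsReflection (g : LinearMap.GeneralLinearGroup ℂ V) : Prop :=
  IsOfFinOrder g ∧ ∃ W : Submodule ℂ V, Module.finrank ℂ W + 1 = Module.finrank ℂ V ∧
    ∀ w ∈ W, (g : V →ₗ[ℂ] V) w = w

/-- A complex reflection group: a finite subgroup of `GL(V)` that is generated by
reflections. -/
def IsReflectionGroup (G : Subgroup (LinearMap.GeneralLinearGroup ℂ V)) : Prop :=
  Finite G ∧ Subgroup.closure {g | g ∈ G ∧ IsReflection g} = G

/-- The action of `G ≤ GL(V)` on `V*`. -/
noncomputable def dualRep (G : Subgroup (LinearMap.GeneralLinearGroup ℂ V)) :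
    Representation ℂ G (Module.Dual ℂ V) :=
  Representation.dual ((Units.coeHom (V →ₗ[ℂ] V)).comp G.subtype : Representation ℂ G V)

variable {G : Subgroup (LinearMap.GeneralLinearGroup ℂ V)}

/-- Fundamental invariants of `N` with `G`-stable span: algebraically independent homogeneous
polynomials `N_1, …, N_r` in `S(V*)`, where `r = dim V`, that generate the algebra `S(V*)^N` and
whose linear span is stable under `G`. -/
structure StableInvariants (N : Subgroup G) where
  /-- The polynomials `N_1, …, N_r`. -/
  inv : Fin (Module.finrank ℂ V) → SymmetricAlgebra ℂ (Module.Dual ℂ V)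
  homogeneous : ∀ i, ∃ d, inv i ∈ homogeneousPart (Module.Dual ℂ V) d
  algebraicIndependent : AlgebraicIndependent ℂ inv
  mem_adjoin_iff : ∀ p, p ∈ Algebra.adjoin ℂ (Set.range inv) ↔
    ∀ n ∈ N, symRep (dualRep G) n p = p
  stable : ∀ g, Submodule.span ℂ (Set.range inv) ≤
    (Submodule.span ℂ (Set.range inv)).comap (symRep (dualRep G) g)

namespace StableInvariants

variable {N : Subgroup G} (B : StableInvariants N)

/-- The space `E*` of linear functions on `E = V/N`: the span of `N_1, …, N_r`. -/
noncomputable def Edual : Submodule ℂ (SymmetricAlgebra ℂ (Module.Dual ℂ V)) :=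
  Submodule.span ℂ (Set.range B.inv)

/-- The action of `G` on `E*`. -/
noncomputable def repG : Representation ℂ G B.Edual :=
  (symRep (dualRep G)).subrepresentation B.Edual B.stable

instance : Representation.IsTrivial (B.repG.comp N.subtype) where
  out n := by
    ext ⟨p, hp⟩
    have hp' : p ∈ Algebra.adjoin ℂ (Set.range B.inv) := Algebra.span_le_adjoin ℂ _ hp
    exact (B.mem_adjoin_iff p).1 hp' n n.2

/-- The action of `H = G/N` on `E*`. -/
noncomputable def repH [N.Normal] : Representation ℂ (G ⧸ N) B.Edual :=
  B.repG.ofQuotient N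

/-- The `H`-harmonic polynomials in `S(E*)`. -/
noncomputable abbrev CH [N.Normal] : Submodule ℂ (SymmetricAlgebra ℂ B.Edual) :=
  harmonic B.repH ⊤

/-- The `H`-module of `H`-harmonic polynomials. -/
noncomputable abbrev repCH [N.Normal] : Representation ℂ (G ⧸ N) B.CH :=
  harmonicRep B.repH ⊤

/-- The canonical homomorphism `S(E*) → S(V*)` that extends the inclusion of `E*`; it identifies
`S(E*)` with `S(V*)^N`. -/
noncomputable def toPoly :
    SymmetricAlgebra ℂ B.Edual →ₐ[ℂ] SymmetricAlgebra ℂ (Module.Dual ℂ V) :=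
  SymmetricAlgebra.lift B.Edual.subtype

/-- The part of degree `d` of the space of `H`-harmonic polynomials, for the degree inherited
from `S(V*)`, in which `N_i` has its degree as a polynomial on `V`. -/
noncomputable def CHdeg [N.Normal] (d : ℕ) : Submodule ℂ B.CH :=
  (homogeneousPart (Module.Dual ℂ V) d).comap (B.toPoly.toLinearMap ∘ₗ B.CH.subtype)

end StableInvariants

/-- The `N`-harmonic polynomials in `S(V*)`. -/
noncomputable abbrev C (N : Subgroup G) : Submodule ℂ (SymmetricAlgebra ℂ (Module.Dual ℂ V)) :=
  harmonic (dualRep G) N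

/-- The `G`-module of `N`-harmonic polynomials. -/
noncomputable abbrev repC (N : Subgroup G) [N.Normal] : Representation ℂ G (C N) :=
  harmonicRep (dualRep G) N

/-- The part of degree `d` of the space of `N`-harmonic polynomials. -/
noncomputable def Cdeg (N : Subgroup G) (d : ℕ) : Submodule ℂ (C N) :=
  (homogeneousPart (Module.Dual ℂ V) d).comap (C N).subtype

/-- The part of degree `d` of the graded tensor product `C_H ⊗ C_N`. -/
noncomputable def tensorDeg {N : Subgroup G} [N.Normal] (B : StableInvariants N) (d : ℕ) :
    Submodule ℂ (B.CH ⊗[ℂ] C N) :=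
  Submodule.span ℂ {t | ∃ i j, i + j = d ∧ ∃ a ∈ B.CHdeg i, ∃ b ∈ Cdeg N j, t = a ⊗ₜ[ℂ] b}

end Reflection

end HarmonicPoly

open HarmonicPoly

/-!
Write `S = S(V*)`, and for a finite group `K` let `I_K ⊆ S` be the Hilbert ideal, generated by the
`K`-invariants without constant term.

For every finite group the harmonic polynomials are a graded, stable complement of the Hilbert
ideal (`isCompl_hilbertIdeal_harmonic`): for an invariant Hermitian form on `V*`, the form
`⟨a, f⟩ = (ā(∂) f)(0)` on `S` is positive definite, by Euler's identity and induction on the degree,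
and multiplication by `q` is adjoint to `q̄(∂)`, so that `C_K` is the orthogonal complement of
`I_K`. Graded subspaces are handled as the subspaces stable under the automorphism that doubles
`V*`.

The reflections of `N` enter through their divided differences `f ↦ (f - s f) / α`, which are linear
over `S^N`. A homogeneous polynomial outside `I_N` is mapped to a nonzero constant by a composition
of them (`exists_lowerOps_ne_zero`). Two things follow.

* `S^N` is a polynomial algebra (`exists_stable_generators`). Generators are taken from a
  `G`-stable graded complement of the decomposable invariants. Composing divided differences with
  partial derivatives gives derivations of `S^N` that are dual to such generators, and these force
  every algebraic relation among the generators to be trivial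
  (`algebraicIndependent_of_invDers`). Their number is the transcendence degree of `S`.
* `C_N` is independent over `S^N`, even modulo `I_G`: if `∑ c_i b_i ∈ I_G` with `c_i ∈ S^N` and
  `b_i` in a homogeneous basis of `C_N`, then all `c_i ∈ I_G` (`coeff_mem_hilbertIdeal`).

Now `S = C_N · S^N + I_G` by the graded Nakayama lemma and `S^N = C_H ⊕ I_H`, so that
multiplication followed by the projection along `I_G` maps `C_H ⊗ C_N` onto `C_G`; it is injective
by the independence of `C_N` and `C_H ∩ I_H = 0` (`bijective_harmonicProj_harmonicMul`). An
`N`-invariant element of `C_G` is in `S^N = C_H ⊕ I_H`, hence is the image of an element of `C_H`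
(`exists_harmonicIncl_eq`).
-/

open scoped TensorProduct
open HarmonicPoly

namespace HarmonicPoly

/-! ### Gradings by eigenspaces of a dilation -/

section Eigen

variable {X : Type*} [AddCommGroup X] [Module ℂ X] (t : Module.End ℂ X)

theorem iSupIndep_eigenspace_two_pow :
    iSupIndep fun d : ℕ => t.eigenspace ((2 : ℂ) ^ d) := by
  refine t.eigenspaces_iSupIndep.comp fun a b h => ?_
  have : (2 : ℕ) ^ a = 2 ^ b := by exact_mod_cast h
  exact Nat.pow_right_injective le_rfl this

variable {t}

theorem mem_of_mem_iSup_of_mem_eigenspace {Y : ℕ → Submodule ℂ X}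
    (hY : ∀ k, Y k ≤ t.eigenspace ((2 : ℂ) ^ k)) {f : X} (hf : f ∈ ⨆ k, Y k) {d : ℕ}
    (hd : f ∈ t.eigenspace ((2 : ℂ) ^ d)) : f ∈ Y d := by
  classical
  rw [iSup_split_single Y d, Submodule.mem_sup] at hf
  obtain ⟨y, hy, z, hz, rfl⟩ := hf
  have hz' : z ∈ t.eigenspace ((2 : ℂ) ^ d) := by
    simpa using Submodule.sub_mem _ hd (hY d hy)
  have := (iSupIndep_eigenspace_two_pow t d).le_bot
    ⟨hz', (iSup₂_mono fun k _ => hY k) hz⟩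
  rw [Submodule.mem_bot] at this
  simpa [this] using hy

theorem sum_mem_eigenspace_separate {M : Submodule ℂ X} (hM : ∀ f ∈ M, t f ∈ M)
    (s : Finset ℕ) (x : ℕ → X) (hx : ∀ k, x k ∈ t.eigenspace ((2 : ℂ) ^ k))
    (h : ∑ k ∈ s, x k ∈ M) : ∀ k ∈ s, x k ∈ M := by
  classical
  induction s using Finset.induction_on generalizing x with
  | empty => simp
  | insert a s ha ih =>
    have ht : ∀ k, t (x k) = (2 : ℂ) ^ k • x k := fun k =>
      Module.End.mem_eigenspace_iff.1 (hx k)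
    have h1 : ∑ k ∈ s, ((2 : ℂ) ^ k - 2 ^ a) • x k ∈ M := by
      have := Submodule.sub_mem _ (hM _ h) (M.smul_mem ((2 : ℂ) ^ a) h)
      rw [map_sum, Finset.smul_sum, ← Finset.sum_sub_distrib, Finset.sum_insert ha] at this
      simpa [ht, sub_smul] using this
    have h2 : ∀ k ∈ s, x k ∈ M := by
      intro k hk
      have := ih _ (fun k => Submodule.smul_mem _ _ (hx k)) h1 k hk
      have hne : (2 : ℂ) ^ k - 2 ^ a ≠ 0 := by
        rw [sub_ne_zero]
        intro h
        have : (2 : ℕ) ^ k = 2 ^ a := by exact_mod_cast h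
        exact ha (Nat.pow_right_injective le_rfl this ▸ hk)
      exact (Submodule.smul_mem_iff _ hne).1 this
    intro k hk
    rcases Finset.mem_insert.1 hk with rfl | hk
    · rw [Finset.sum_insert ha] at h
      exact (Submodule.add_mem_iff_left _ (Submodule.sum_mem _ h2)).1 h
    · exact h2 k hk

/-- A submodule stable under a dilation is the sum of its homogeneous parts. -/
theorem le_iSup_inf_eigenspace {M : Submodule ℂ X} (hM : ∀ f ∈ M, t f ∈ M)
    (ht : M ≤ ⨆ k : ℕ, t.eigenspace ((2 : ℂ) ^ k)) :
    M ≤ ⨆ k : ℕ, M ⊓ t.eigenspace ((2 : ℂ) ^ k) := by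
  classical
  intro f hf
  obtain ⟨x, hx, rfl⟩ := (Submodule.mem_iSup_iff_exists_finsupp _ _).1 (ht hf)
  have := sum_mem_eigenspace_separate hM x.support x hx hf
  exact Submodule.sum_mem _ fun k hk =>
    Submodule.mem_iSup_of_mem k ⟨this k hk, hx k⟩

theorem eq_eigenspace_of_iSup_eq_top {Y : ℕ → Submodule ℂ X}
    (hY : ∀ k, Y k ≤ t.eigenspace ((2 : ℂ) ^ k)) (h : ⨆ k, Y k = ⊤) (d : ℕ) :
    Y d = t.eigenspace ((2 : ℂ) ^ d) :=
  le_antisymm (hY d) fun _ hf => mem_of_mem_iSup_of_mem_eigenspace hY (h ▸ Submodule.mem_top) hf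

end Eigen

section Dilation

variable {U : Type*} [AddCommGroup U] [Module ℂ U]

/-- The action of the multiplicative group of scalars on a vector space. -/
noncomputable def scalarRep (U : Type*) [AddCommGroup U] [Module ℂ U] :
    Representation ℂ ℂˣ U where
  toFun c := (c : ℂ) • LinearMap.id
  map_one' := by ext; simp
  map_mul' a b := by ext u; simp only [Units.val_mul, mul_smul]; rfl

@[simp] theorem scalarRep_apply (c : ℂˣ) (u : U) : scalarRep U c u = (c : ℂ) • u := rfl

/-- The scalar `2`. Only the fact that its powers are distinct matters. -/
noncomputable def two : ℂˣ := Units.mk0 2 two_ne_zero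

/-- The algebra automorphism of `S(U)` that multiplies `U` by `2`. Its eigenspace for `2 ^ d` is
the homogeneous part of degree `d`, so that graded subspaces are the subspaces it preserves. -/
noncomputable def dilation (U : Type*) [AddCommGroup U] [Module ℂ U] :
    Module.End ℂ (SymmetricAlgebra ℂ U) :=
  symRep (scalarRep U) two

@[simp] theorem dilation_mul (a b : SymmetricAlgebra ℂ U) :
    dilation U (a * b) = dilation U a * dilation U b := symRep_mul _ _ _ _

@[simp] theorem dilation_ι (u : U) :
    dilation U (SymmetricAlgebra.ι ℂ U u) = (2 : ℂ) • SymmetricAlgebra.ι ℂ U u := by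
  simp [dilation, two]

@[simp] theorem dilation_algebraMap (c : ℂ) :
    dilation U (algebraMap ℂ _ c) = algebraMap ℂ _ c := symRep_algebraMap _ _ _

theorem homogeneousPart_mul_le (k l : ℕ) :
    homogeneousPart U k * homogeneousPart U l = homogeneousPart U (k + l) :=
  (pow_add _ _ _).symm

theorem mul_mem_homogeneousPart {k l : ℕ} {a b : SymmetricAlgebra ℂ U}
    (ha : a ∈ homogeneousPart U k) (hb : b ∈ homogeneousPart U l) :
    a * b ∈ homogeneousPart U (k + l) :=
  homogeneousPart_mul_le (U := U) k l ▸ Submodule.mul_mem_mul ha hb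

theorem ι_mem_homogeneousPart (u : U) : SymmetricAlgebra.ι ℂ U u ∈ homogeneousPart U 1 := by
  rw [homogeneousPart, pow_one]; exact ⟨u, rfl⟩

theorem mem_homogeneousPart_zero {f : SymmetricAlgebra ℂ U} :
    f ∈ homogeneousPart U 0 ↔ ∃ c, algebraMap ℂ _ c = f := by
  rw [homogeneousPart, pow_zero, Submodule.mem_one]

theorem iSup_homogeneousPart : ⨆ d, homogeneousPart U d = ⊤ := by
  rw [eq_top_iff]
  rintro f -
  induction f using SymmetricAlgebra.induction with
  | algebraMap c => exact Submodule.mem_iSup_of_mem 0 (mem_homogeneousPart_zero.2 ⟨c, rfl⟩)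
  | ι u => exact Submodule.mem_iSup_of_mem 1 (ι_mem_homogeneousPart u)
  | mul a b ha hb =>
    have : a * b ∈ (⨆ d, homogeneousPart U d) * ⨆ d, homogeneousPart U d :=
      Submodule.mul_mem_mul ha hb
    simp only [Submodule.iSup_mul, Submodule.mul_iSup, homogeneousPart_mul_le] at this
    exact (iSup_le fun k => iSup_le fun l => le_iSup (homogeneousPart U) (l + k)) this
  | add a b ha hb => exact Submodule.add_mem _ ha hb

theorem symRep_scalarRep_of_mem (c : ℂˣ) {d : ℕ} {f : SymmetricAlgebra ℂ U}
    (hf : f ∈ homogeneousPart U d) : symRep (scalarRep U) c f = (c : ℂ) ^ d • f := by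
  refine Submodule.pow_induction_on_left' (LinearMap.range (SymmetricAlgebra.ι ℂ U))
    (C := fun d f _ => symRep (scalarRep U) c f = (c : ℂ) ^ d • f) (by simp)
    (fun x y i _ _ hx hy => by rw [map_add, hx, hy, smul_add]) ?_ hf
  rintro _ ⟨u, rfl⟩ i x _ hx
  rw [symRep_mul, hx, symRep_ι, scalarRep_apply, map_smul, smul_mul_smul_comm, pow_succ']

theorem homogeneousPart_eq_eigenspace (d : ℕ) :
    homogeneousPart U d = (dilation U).eigenspace ((2 : ℂ) ^ d) := by
  refine eq_eigenspace_of_iSup_eq_top (fun k f hf => ?_) iSup_homogeneousPart d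
  rw [Module.End.mem_eigenspace_iff]
  exact symRep_scalarRep_of_mem two hf

theorem mem_homogeneousPart_iff {d : ℕ} {f : SymmetricAlgebra ℂ U} :
    f ∈ homogeneousPart U d ↔ dilation U f = (2 : ℂ) ^ d • f := by
  rw [homogeneousPart_eq_eigenspace, Module.End.mem_eigenspace_iff]

/-- A subspace of `S(U)` is graded if it is stable under the dilation. -/
def IsGraded (M : Submodule ℂ (SymmetricAlgebra ℂ U)) : Prop := ∀ f ∈ M, dilation U f ∈ M

theorem IsGraded.le_iSup {M : Submodule ℂ (SymmetricAlgebra ℂ U)} (hM : IsGraded M) :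
    M ≤ ⨆ k : ℕ, M ⊓ homogeneousPart U k := by
  simp only [homogeneousPart_eq_eigenspace]
  refine le_iSup_inf_eigenspace hM ?_
  simp only [← homogeneousPart_eq_eigenspace, iSup_homogeneousPart, le_top]

theorem IsGraded.iSup_comap_subtype {M : Submodule ℂ (SymmetricAlgebra ℂ U)} (hM : IsGraded M) :
    ⨆ k : ℕ, (homogeneousPart U k).comap M.subtype = ⊤ := by
  rw [eq_top_iff]
  rintro f -
  have h := hM.le_iSup f.2
  simp only [← Submodule.map_comap_subtype, ← Submodule.map_iSup] at h
  obtain ⟨g, hg, h⟩ := h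
  rwa [← Subtype.ext h]

theorem isGraded_top : IsGraded (⊤ : Submodule ℂ (SymmetricAlgebra ℂ U)) :=
  fun _ _ => Submodule.mem_top

theorem IsGraded.inf {M M' : Submodule ℂ (SymmetricAlgebra ℂ U)} (hM : IsGraded M)
    (hM' : IsGraded M') : IsGraded (M ⊓ M') := fun f hf => ⟨hM f hf.1, hM' f hf.2⟩

theorem IsGraded.mul {M M' : Submodule ℂ (SymmetricAlgebra ℂ U)} (hM : IsGraded M)
    (hM' : IsGraded M') : IsGraded (M * M') := by
  intro f hf
  refine Submodule.mul_induction_on hf (fun a ha b hb => ?_) fun a b ha hb => ?_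
  · rw [dilation_mul]
    exact Submodule.mul_mem_mul (hM a ha) (hM' b hb)
  · rw [map_add]; exact Submodule.add_mem _ ha hb

theorem IsGraded.eq_bot {M : Submodule ℂ (SymmetricAlgebra ℂ U)} (hM : IsGraded M)
    (h : ∀ d, ∀ f ∈ M, f ∈ homogeneousPart U d → f = 0) : M = ⊥ := by
  rw [eq_bot_iff]
  exact hM.le_iSup.trans (iSup_le fun d f hf => h d f hf.1 hf.2)

theorem IsGraded.le {M M' : Submodule ℂ (SymmetricAlgebra ℂ U)} (hM : IsGraded M)
    (h : ∀ d, ∀ f ∈ M, f ∈ homogeneousPart U d → f ∈ M') : M ≤ M' :=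
  hM.le_iSup.trans (iSup_le fun d f hf => h d f hf.1 hf.2)

theorem mem_of_mem_iSup_of_mem_homogeneousPart {Y : ℕ → Submodule ℂ (SymmetricAlgebra ℂ U)}
    (hY : ∀ k, Y k ≤ homogeneousPart U k) {f : SymmetricAlgebra ℂ U} (hf : f ∈ ⨆ k, Y k) {d : ℕ}
    (hd : f ∈ homogeneousPart U d) : f ∈ Y d := by
  simp only [homogeneousPart_eq_eigenspace] at hY hd
  exact mem_of_mem_iSup_of_mem_eigenspace hY hf hd

/-- The degree `d` part of a product of graded subspaces. -/
theorem IsGraded.mul_inf_le {M M' : Submodule ℂ (SymmetricAlgebra ℂ U)} (hM : IsGraded M)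
    (hM' : IsGraded M') (d : ℕ) :
    M * M' ⊓ homogeneousPart U d ≤
      ⨆ p ∈ Finset.HasAntidiagonal.antidiagonal d,
        (M ⊓ homogeneousPart U p.1) * (M' ⊓ homogeneousPart U p.2) := by
  rintro f ⟨hf, hd⟩
  refine mem_of_mem_iSup_of_mem_homogeneousPart
    (Y := fun d => ⨆ p ∈ Finset.HasAntidiagonal.antidiagonal d,
        (M ⊓ homogeneousPart U p.1) * (M' ⊓ homogeneousPart U p.2)) (fun k => ?_) ?_ hd
  · refine iSup₂_le fun p hp => ?_
    rw [← Finset.HasAntidiagonal.mem_antidiagonal.1 hp, ← homogeneousPart_mul_le]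
    exact mul_le_mul' inf_le_right inf_le_right
  · have := mul_le_mul' hM.le_iSup hM'.le_iSup hf
    simp only [Submodule.iSup_mul, Submodule.mul_iSup] at this
    refine SetLike.le_def.1 (iSup_le fun l => iSup_le fun k => ?_) this
    exact le_iSup_of_le (k + l) (le_iSup₂_of_le (k, l)
      (Finset.HasAntidiagonal.mem_antidiagonal.2 rfl) le_rfl)

instance [FiniteDimensional ℂ U] (d : ℕ) : FiniteDimensional ℂ (homogeneousPart U d) := by
  refine Module.Finite.iff_fg.2 (Submodule.FG.pow ?_ d)
  exact Module.Finite.iff_fg.1 inferInstance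

theorem algebraMapInv_dilation (f : SymmetricAlgebra ℂ U) :
    SymmetricAlgebra.algebraMapInv (dilation U f) = SymmetricAlgebra.algebraMapInv f :=
  algebraMapInv_symRep _ _ _

theorem algebraMapInv_eq_zero_of_mem {d : ℕ} (hd : d ≠ 0) {f : SymmetricAlgebra ℂ U}
    (hf : f ∈ homogeneousPart U d) : SymmetricAlgebra.algebraMapInv f = 0 := by
  have h := algebraMapInv_dilation f
  rw [mem_homogeneousPart_iff.1 hf, map_smul, smul_eq_mul] at h
  by_contra h0
  have h1 : (2 : ℂ) ^ d = 1 := mul_right_cancel₀ h0 (by rw [h, one_mul])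
  have h2 : (2 : ℕ) ^ d = 1 := by exact_mod_cast h1
  simp [hd] at h2

theorem eq_zero_of_mem_homogeneousPart_zero {f : SymmetricAlgebra ℂ U}
    (hf : f ∈ homogeneousPart U 0) (h : SymmetricAlgebra.algebraMapInv f = 0) : f = 0 := by
  obtain ⟨c, rfl⟩ := mem_homogeneousPart_zero.1 hf
  rw [SymmetricAlgebra.algebraMap_leftInverse] at h
  rw [h, map_zero]

theorem dirDeriv_dilation (ξ : Module.Dual ℂ U) (f : SymmetricAlgebra ℂ U) :
    dirDeriv ξ (dilation U f) = (2 : ℂ) • dilation U (dirDeriv ξ f) := by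
  have h := dirDeriv_equivariant (scalarRep U) two ((2 : ℂ) • ξ) f
  have e : (scalarRep U).dual two ((2 : ℂ) • ξ) = ξ := by
    ext v
    simp [Module.Dual.transpose_apply, two]
  have e' : dirDeriv ((2 : ℂ) • ξ) = (2 : ℂ) • dirDeriv ξ := by
    apply derivation_ext; simp [Algebra.smul_def]
  rw [e, e', Derivation.smul_apply, map_smul] at h
  exact h

end Dilation

/-! ### The invariant Hermitian form on polynomials -/

section Form

open Module

variable {U : Type*} [AddCommGroup U] [Module ℂ U] {K : Type*} [Group K]

theorem exists_invariant_orthonormal_basis [FiniteDimensional ℂ U] [Finite K]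
    (ρ : Representation ℂ K U) :
    ∃ (n : ℕ) (b : Basis (Fin n) ℂ U) (J : U →ₛₗ[starRingEnd ℂ] Dual ℂ U),
      (∀ i, J (b i) = b.coord i) ∧ ∀ g u, J (ρ g u) = ρ.dual g (J u) := by
  classical
  have := Fintype.ofFinite K
  let c := Module.finBasis ℂ U
  let core : InnerProductSpace.Core ℂ U :=
    { inner := fun x y => ∑ g : K, ∑ i, c.repr (ρ g y) i * starRingEnd ℂ (c.repr (ρ g x) i)
      conj_inner_symm := fun x y => by simp [mul_comm]
      re_inner_nonneg := fun x => by
        simp only [Complex.mul_conj, map_sum]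
        exact Finset.sum_nonneg fun g _ => Finset.sum_nonneg fun i _ => by
          simpa using Complex.normSq_nonneg _
      add_left := fun x y z => by
        simp [mul_add, Finset.sum_add_distrib]
      smul_left := fun x y r => by
        simp only [map_smul, Finsupp.smul_apply, smul_eq_mul, map_mul, Finset.mul_sum]
        exact Finset.sum_congr rfl fun g _ => Finset.sum_congr rfl fun i _ => by ring
      definite := fun x hx => by
        simp only [Complex.mul_conj] at hx
        norm_cast at hx
        have h1 := (Finset.sum_eq_zero_iff_of_nonneg fun g _ => Finset.sum_nonneg fun i _ =>
          Complex.normSq_nonneg _).1 hx 1 (Finset.mem_univ _)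
        have h2 := (Finset.sum_eq_zero_iff_of_nonneg fun i _ => Complex.normSq_nonneg _).1 h1
        apply c.ext_elem
        intro i
        simpa using h2 i (Finset.mem_univ _) }
  let : NormedAddCommGroup U := core.toNormedAddCommGroup
  let : InnerProductSpace ℂ U := .ofCore core.toCore
  let b := stdOrthonormalBasis ℂ U
  refine ⟨_, b.toBasis, innerₛₗ ℂ, fun i => ?_, fun g u => ?_⟩
  · apply b.toBasis.ext
    intro j
    simp [orthonormal_iff_ite.1 b.orthonormal]
  · ext v
    change ∑ h : K, ∑ i, c.repr (ρ h v) i * starRingEnd ℂ (c.repr (ρ h (ρ g u)) i) =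
      ∑ h : K, ∑ i, c.repr (ρ h (ρ g⁻¹ v)) i * starRingEnd ℂ (c.repr (ρ h u) i)
    refine Fintype.sum_equiv (Equiv.mulRight g) _ _ fun h => ?_
    simp [← Module.End.mul_apply, ← map_mul]

variable {n : ℕ} (b : Basis (Fin n) ℂ U)

/-- The conjugate-linear ring homomorphism `S(U) → S(U*)` that sends a basis to its dual basis. -/
noncomputable def conjDual : SymmetricAlgebra ℂ U →+* SymmetricAlgebra ℂ (Dual ℂ U) :=
  (MvPolynomial.eval₂Hom ((algebraMap ℂ _).comp (starRingEnd ℂ))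
    fun i => SymmetricAlgebra.ι ℂ _ (b.coord i)).comp
      (SymmetricAlgebra.equivMvPolynomial b : SymmetricAlgebra ℂ U →+* MvPolynomial (Fin n) ℂ)

@[simp] theorem conjDual_algebraMap (c : ℂ) :
    conjDual b (algebraMap ℂ _ c) = algebraMap ℂ _ (starRingEnd ℂ c) := by
  simp [conjDual]

theorem conjDual_smul (c : ℂ) (a : SymmetricAlgebra ℂ U) :
    conjDual b (c • a) = starRingEnd ℂ c • conjDual b a := by
  rw [Algebra.smul_def, map_mul, conjDual_algebraMap, ← Algebra.smul_def]

@[simp] theorem conjDual_ι_basis (i : Fin n) :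
    conjDual b (SymmetricAlgebra.ι ℂ U (b i)) = SymmetricAlgebra.ι ℂ _ (b.coord i) := by
  simp [conjDual]

variable {b} {J : U →ₛₗ[starRingEnd ℂ] Dual ℂ U}

theorem conjDual_ι (hJ : ∀ i, J (b i) = b.coord i) (u : U) :
    conjDual b (SymmetricAlgebra.ι ℂ U u) = SymmetricAlgebra.ι ℂ _ (J u) := by
  conv_lhs => rw [← b.sum_repr u]
  conv_rhs => rw [← b.sum_repr u]
  simp only [map_sum, map_smul, conjDual_smul, conjDual_ι_basis, LinearMap.map_smulₛₗ, hJ]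

theorem conjDual_symRep (hJ : ∀ i, J (b i) = b.coord i) {ρ : Representation ℂ K U}
    {L : Type*} [Group L] {ρ' : Representation ℂ L (Dual ℂ U)} {g : K} {g' : L}
    (h : ∀ u, J (ρ g u) = ρ' g' (J u)) (a : SymmetricAlgebra ℂ U) :
    conjDual b (symRep ρ g a) = symRep ρ' g' (conjDual b a) := by
  induction a using SymmetricAlgebra.induction with
  | algebraMap c => simp
  | ι u => rw [symRep_ι, conjDual_ι hJ, conjDual_ι hJ, symRep_ι, h]
  | mul a b ha hb => simp [ha, hb]
  | add a b ha hb => simp [ha, hb]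

theorem algebraMapInv_conjDual (a : SymmetricAlgebra ℂ U) :
    SymmetricAlgebra.algebraMapInv (conjDual b a) =
      starRingEnd ℂ (SymmetricAlgebra.algebraMapInv a) := by
  induction a using SymmetricAlgebra.induction with
  | algebraMap c => simp
  | ι u =>
    rw [SymmetricAlgebra.algebraMapInv_ι, map_zero, ← b.sum_repr u]
    simp only [map_sum, map_smul, conjDual_smul, conjDual_ι_basis,
      SymmetricAlgebra.algebraMapInv_ι, smul_zero, Finset.sum_const_zero]
  | mul a b ha hb => simp [ha, hb]
  | add a b ha hb => simp [ha, hb]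

theorem conjDual_surjective : Function.Surjective (conjDual b) := by
  intro p
  change p ∈ (conjDual b).range
  induction p using SymmetricAlgebra.induction with
  | algebraMap c => exact ⟨algebraMap ℂ _ (starRingEnd ℂ c), by simp⟩
  | ι ξ =>
    refine ⟨∑ i, starRingEnd ℂ (ξ (b i)) • SymmetricAlgebra.ι ℂ U (b i), ?_⟩
    simp only [map_sum, conjDual_smul, conjDual_ι_basis, Complex.conj_conj]
    simp only [← map_smul, ← map_sum]
    congr 1
    apply b.ext
    intro j
    simp
  | mul a b ha hb => exact mul_mem ha hb
  | add a b ha hb => exact add_mem ha hb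

variable (b) in
/-- The sesquilinear form `⟨a, f⟩ = (ā(∂) f)(0)` on `S(U)`, for which multiplication by a basis
vector is adjoint to the corresponding partial derivative. -/
noncomputable def polyForm :
    SymmetricAlgebra ℂ U →ₛₗ[starRingEnd ℂ] SymmetricAlgebra ℂ U →ₗ[ℂ] ℂ where
  toFun a := SymmetricAlgebra.algebraMapInv.toLinearMap ∘ₗ diffOp (conjDual b a)
  map_add' a a' := by ext f; simp
  map_smul' c a := by ext f; simp [conjDual_smul]

theorem polyForm_apply (a f : SymmetricAlgebra ℂ U) :
    polyForm b a f = SymmetricAlgebra.algebraMapInv (diffOp (conjDual b a) f) := rfl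

theorem polyForm_mul_left (a q f : SymmetricAlgebra ℂ U) :
    polyForm b (a * q) f = polyForm b a (diffOp (conjDual b q) f) := by
  simp [polyForm_apply]

theorem polyForm_basis_mul (i : Fin n) (a f : SymmetricAlgebra ℂ U) :
    polyForm b (SymmetricAlgebra.ι ℂ U (b i) * a) f = polyForm b a (dirDeriv (b.coord i) f) := by
  rw [mul_comm, polyForm_mul_left, conjDual_ι_basis, diffOp_ι]

theorem polyForm_symRep (hJ : ∀ i, J (b i) = b.coord i) {ρ : Representation ℂ K U}
    {g : K} (h : ∀ u, J (ρ g u) = ρ.dual g (J u)) (a f : SymmetricAlgebra ℂ U) :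
    polyForm b (symRep ρ g a) (symRep ρ g f) = polyForm b a f := by
  rw [polyForm_apply, conjDual_symRep hJ h, diffOp_equivariant, algebraMapInv_symRep,
    polyForm_apply]

theorem polyForm_dilation (hJ : ∀ i, J (b i) = b.coord i) (a f : SymmetricAlgebra ℂ U) :
    polyForm b (dilation U a) f = polyForm b a (dilation U f) := by
  have h : ∀ u, J (scalarRep U two u) = (scalarRep U).dual two⁻¹ (J u) := by
    intro u
    ext v
    simp [Dual.transpose_apply, two, Complex.conj_ofNat]
  have e := diffOp_equivariant (scalarRep U) two ((symRep (scalarRep U).dual two⁻¹)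
    (conjDual b a)) f
  rw [← Module.End.mul_apply (symRep _ _), ← map_mul, mul_inv_cancel, map_one,
    Module.End.one_apply] at e
  rw [polyForm_apply, polyForm_apply, dilation, conjDual_symRep hJ h, e, algebraMapInv_symRep]

theorem dirDeriv_mem_homogeneousPart (ξ : Dual ℂ U) {d : ℕ} {f : SymmetricAlgebra ℂ U}
    (hf : f ∈ homogeneousPart U (d + 1)) : dirDeriv ξ f ∈ homogeneousPart U d := by
  have h := dirDeriv_dilation ξ f
  rw [mem_homogeneousPart_iff] at hf ⊢
  rw [hf, Derivation.map_smul, pow_succ', mul_smul] at h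
  exact (smul_right_injective _ (two_ne_zero (α := ℂ)) h).symm

variable (b) in
/-- Euler's identity. -/
theorem sum_basis_mul_dirDeriv {d : ℕ} {f : SymmetricAlgebra ℂ U}
    (hf : f ∈ homogeneousPart U d) :
    ∑ i, SymmetricAlgebra.ι ℂ U (b i) * dirDeriv (b.coord i) f = (d : ℂ) • f := by
  refine Submodule.pow_induction_on_left' (LinearMap.range (SymmetricAlgebra.ι ℂ U))
    (C := fun d f _ => ∑ i, SymmetricAlgebra.ι ℂ U (b i) * dirDeriv (b.coord i) f = (d : ℂ) • f)
    (by simp) (fun x y i _ _ hx hy => ?_) ?_ hf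
  · simp only [map_add, mul_add, Finset.sum_add_distrib, hx, hy, smul_add]
  · rintro _ ⟨u, rfl⟩ k x _ hx
    have hu : ∑ i, SymmetricAlgebra.ι ℂ U (b i) * algebraMap ℂ _ (b.coord i u) =
        SymmetricAlgebra.ι ℂ U u := by
      conv_rhs => rw [← b.sum_repr u]
      simp only [map_sum, map_smul, Algebra.smul_def, mul_comm, Basis.coord_apply]
    simp only [Derivation.leibniz, dirDeriv_ι, smul_eq_mul, mul_add, Finset.sum_add_distrib]
    have e1 : ∀ i, SymmetricAlgebra.ι ℂ U (b i) *
        (SymmetricAlgebra.ι ℂ U u * dirDeriv (b.coord i) x) =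
        SymmetricAlgebra.ι ℂ U u * (SymmetricAlgebra.ι ℂ U (b i) * dirDeriv (b.coord i) x) :=
      fun i => by ring
    have e2 : ∀ i, SymmetricAlgebra.ι ℂ U (b i) * (x * algebraMap ℂ _ (b.coord i u)) =
        x * (SymmetricAlgebra.ι ℂ U (b i) * algebraMap ℂ _ (b.coord i u)) := fun i => by ring
    simp only [e1, e2, ← Finset.mul_sum, hx, hu]
    rw [Nat.succ_eq_add_one, Nat.cast_succ, add_smul, one_smul, mul_smul_comm, mul_comm x]

theorem natCast_mul_polyForm {d : ℕ} {a : SymmetricAlgebra ℂ U} (f : SymmetricAlgebra ℂ U)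
    (ha : a ∈ homogeneousPart U d) :
    d * polyForm b a f =
      ∑ i, polyForm b (dirDeriv (b.coord i) a) (dirDeriv (b.coord i) f) := by
  have := congrArg (fun a => polyForm b a f) (sum_basis_mul_dirDeriv b ha)
  simpa [polyForm_basis_mul] using this.symm

theorem polyForm_conj_symm {d : ℕ} {a f : SymmetricAlgebra ℂ U}
    (ha : a ∈ homogeneousPart U d) (hf : f ∈ homogeneousPart U d) :
    starRingEnd ℂ (polyForm b f a) = polyForm b a f := by
  induction d generalizing a f with
  | zero =>
    obtain ⟨c, rfl⟩ := mem_homogeneousPart_zero.1 ha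
    obtain ⟨c', rfl⟩ := mem_homogeneousPart_zero.1 hf
    simp [polyForm_apply, mul_comm]
  | succ d ih =>
    have h0 : ((d + 1 : ℕ) : ℂ) ≠ 0 := by exact_mod_cast d.succ_ne_zero
    apply mul_left_cancel₀ h0
    rw [natCast_mul_polyForm f ha, ← map_natCast (starRingEnd ℂ), ← map_mul,
      natCast_mul_polyForm a hf, map_sum]
    exact Finset.sum_congr rfl fun i _ => ih (dirDeriv_mem_homogeneousPart _ ha)
      (dirDeriv_mem_homogeneousPart _ hf)

open ComplexOrder in
theorem polyForm_self_nonneg {d : ℕ} {f : SymmetricAlgebra ℂ U}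
    (hf : f ∈ homogeneousPart U d) :
    0 ≤ polyForm b f f ∧ (polyForm b f f = 0 → f = 0) := by
  induction d generalizing f with
  | zero =>
    obtain ⟨c, rfl⟩ := mem_homogeneousPart_zero.1 hf
    have : polyForm b (algebraMap ℂ _ c) (algebraMap ℂ _ c) = Complex.normSq c := by
      simp [polyForm_apply, Complex.normSq_eq_conj_mul_self]
    rw [this]
    refine ⟨by exact_mod_cast Complex.normSq_nonneg c, fun h => ?_⟩
    rw [Complex.ofReal_eq_zero, Complex.normSq_eq_zero] at h
    rw [h, map_zero]
  | succ d ih =>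
    have h0 : (0 : ℂ) < ((d + 1 : ℕ) : ℂ) := by exact_mod_cast d.succ_pos
    have key := natCast_mul_polyForm (b := b) f hf
    have hd := fun i => ih (dirDeriv_mem_homogeneousPart (b.coord i) hf)
    have hs := Finset.sum_nonneg fun i (_ : i ∈ Finset.univ) => (hd i).1
    refine ⟨?_, fun h => ?_⟩
    · rw [← key] at hs
      have := mul_nonneg (inv_nonneg.2 h0.le) hs
      rwa [← mul_assoc, inv_mul_cancel₀ h0.ne', one_mul] at this
    · rw [h, mul_zero, eq_comm, Finset.sum_eq_zero_iff_of_nonneg fun i _ => (hd i).1] at key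
      have e := sum_basis_mul_dirDeriv b hf
      rw [Finset.sum_eq_zero fun i hi => by rw [(hd i).2 (key i hi), mul_zero], eq_comm,
        smul_eq_zero] at e
      exact e.resolve_left h0.ne'

/-- Homogeneous polynomials of different degrees are orthogonal. -/
theorem polyForm_eq_zero_of_ne (hJ : ∀ i, J (b i) = b.coord i) {k d : ℕ} (hkd : k ≠ d)
    {a f : SymmetricAlgebra ℂ U} (ha : a ∈ homogeneousPart U k) (hf : f ∈ homogeneousPart U d) :
    polyForm b a f = 0 := by
  have h := polyForm_dilation hJ a f
  rw [mem_homogeneousPart_iff.1 ha, mem_homogeneousPart_iff.1 hf] at h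
  simp only [LinearMap.map_smulₛₗ, LinearMap.smul_apply, map_smul, smul_eq_mul, map_pow] at h
  by_contra h0
  have h1 := mul_right_cancel₀ h0 h
  have h2 : (2 : ℕ) ^ k = 2 ^ d := by
    rw [Complex.conj_ofNat] at h1
    exact_mod_cast h1
  exact hkd (Nat.pow_right_injective le_rfl h2)

theorem conjDual_injective (hJ : ∀ i, J (b i) = b.coord i) :
    Function.Injective (conjDual b) := by
  have hk : LinearMap.ker (polyForm b) = ⊥ := by
    refine IsGraded.eq_bot (fun a ha => ?_) fun d a ha hd =>
      (polyForm_self_nonneg (b := b) hd).2 (LinearMap.congr_fun (LinearMap.mem_ker.1 ha) a)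
    ext f
    rw [polyForm_dilation hJ, LinearMap.mem_ker.1 ha]
    rfl
  rw [injective_iff_map_eq_zero]
  intro a ha
  have : a ∈ LinearMap.ker (polyForm b) := by
    ext f
    rw [polyForm_apply, ha, map_zero]
    simp
  rwa [hk] at this

variable (b) in
/-- The orthogonal complement for `polyForm`. -/
noncomputable def polyOrth (W : Submodule ℂ (SymmetricAlgebra ℂ U)) :
    Submodule ℂ (SymmetricAlgebra ℂ U) where
  carrier := {f | ∀ a ∈ W, polyForm b a f = 0}
  zero_mem' := fun a _ => map_zero _
  add_mem' := fun hf hg a ha => by rw [map_add, hf a ha, hg a ha, add_zero]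
  smul_mem' := fun c f hf a ha => by rw [map_smul, hf a ha, smul_zero]

theorem isGraded_polyOrth (hJ : ∀ i, J (b i) = b.coord i)
    {W : Submodule ℂ (SymmetricAlgebra ℂ U)} (hW : IsGraded W) : IsGraded (polyOrth b W) := by
  intro f hf a ha
  rw [← polyForm_dilation hJ]
  exact hf _ (hW a ha)

theorem exists_orthogonal_decomposition (d : ℕ) (W : Submodule ℂ (SymmetricAlgebra ℂ U))
    {f : SymmetricAlgebra ℂ U} (hf : f ∈ homogeneousPart U d) :
    ∃ w ∈ W ⊓ homogeneousPart U d, ∀ a ∈ W ⊓ homogeneousPart U d, polyForm b a (f - w) = 0 := by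
  have : FiniteDimensional ℂ U := b.finiteDimensional_of_finite
  let core : InnerProductSpace.Core ℂ (homogeneousPart U d) :=
    { inner := fun x y => polyForm b x.1 y.1
      conj_inner_symm := fun x y => polyForm_conj_symm x.2 y.2
      re_inner_nonneg := fun x => (Complex.le_def.1 (polyForm_self_nonneg x.2).1).1
      add_left := fun x y z => by simp
      smul_left := fun x y r => by simp
      definite := fun x hx => Subtype.ext ((polyForm_self_nonneg x.2).2 hx) }
  let : NormedAddCommGroup (homogeneousPart U d) := core.toNormedAddCommGroup
  let : InnerProductSpace ℂ (homogeneousPart U d) := .ofCore core.toCore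
  let W' : Submodule ℂ (homogeneousPart U d) := W.comap (homogeneousPart U d).subtype
  obtain ⟨y, hy, z, hz, h⟩ := W'.exists_add_mem_mem_orthogonal ⟨f, hf⟩
  refine ⟨y.1, ⟨hy, y.2⟩, fun a ha => ?_⟩
  have e : f - y.1 = z.1 := by
    rw [sub_eq_iff_eq_add']
    exact congrArg Subtype.val h
  rw [e]
  exact (Submodule.mem_orthogonal _ _).1 hz ⟨a, ha.2⟩ ha.1

theorem isCompl_polyOrth (hJ : ∀ i, J (b i) = b.coord i)
    {W : Submodule ℂ (SymmetricAlgebra ℂ U)} (hW : IsGraded W) : IsCompl W (polyOrth b W) := by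
  constructor
  · rw [disjoint_iff]
    exact (hW.inf (isGraded_polyOrth hJ hW)).eq_bot fun d f hf hd =>
      (polyForm_self_nonneg (b := b) hd).2 (hf.2 f hf.1)
  · rw [codisjoint_iff, eq_top_iff]
    refine isGraded_top.le fun d f _ hd => ?_
    obtain ⟨w, hw, h⟩ := exists_orthogonal_decomposition (b := b) d W hd
    rw [← add_sub_cancel w f]
    refine Submodule.add_mem_sup hw.1 fun a ha => ?_
    have hs := Submodule.sub_mem _ hd hw.2
    refine LinearMap.mem_ker.1 ((hW.le fun k a ha hk => ?_ :
      W ≤ LinearMap.ker ((polyForm b).flip (f - w))) ha)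
    rw [LinearMap.mem_ker, LinearMap.flip_apply]
    rcases eq_or_ne k d with rfl | hkd
    · exact h a ⟨ha, hk⟩
    · exact polyForm_eq_zero_of_ne hJ hkd hk hs

end Form

/-! ### Harmonic polynomials as a complement of the Hilbert ideal -/

section Hilbert

open Module

variable {U : Type*} [AddCommGroup U] [Module ℂ U] {K : Type*} [Group K]

/-- The `N`-invariant polynomials without constant term. -/
noncomputable def posInv (ρ : Representation ℂ K U) (N : Subgroup K) :
    Submodule ℂ (SymmetricAlgebra ℂ U) where
  carrier := {f | (∀ n ∈ N, symRep ρ n f = f) ∧ SymmetricAlgebra.algebraMapInv f = 0}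
  zero_mem' := ⟨fun _ _ => map_zero _, map_zero _⟩
  add_mem' := fun ha hb => ⟨fun n hn => by rw [map_add, ha.1 n hn, hb.1 n hn],
    by rw [map_add, ha.2, hb.2, add_zero]⟩
  smul_mem' := fun c f hf => ⟨fun n hn => by rw [map_smul, hf.1 n hn],
    by rw [map_smul, hf.2, smul_zero]⟩

theorem mem_posInv {ρ : Representation ℂ K U} {N : Subgroup K} {f : SymmetricAlgebra ℂ U} :
    f ∈ posInv ρ N ↔
      (∀ n ∈ N, symRep ρ n f = f) ∧ SymmetricAlgebra.algebraMapInv f = 0 := Iff.rfl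

/-- The Hilbert ideal of `N`: the ideal of `S(U)` generated by the invariants without constant
term, as a subspace. -/
noncomputable def hilbertIdeal (ρ : Representation ℂ K U) (N : Subgroup K) :
    Submodule ℂ (SymmetricAlgebra ℂ U) := ⊤ * posInv ρ N

variable {ρ : Representation ℂ K U} {N : Subgroup K}

theorem mul_mem_hilbertIdeal_of_posInv (a : SymmetricAlgebra ℂ U) {f : SymmetricAlgebra ℂ U}
    (hf : f ∈ posInv ρ N) : a * f ∈ hilbertIdeal ρ N :=
  Submodule.mul_mem_mul Submodule.mem_top hf

theorem posInv_le_hilbertIdeal : posInv ρ N ≤ hilbertIdeal ρ N := fun f hf => by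
  simpa using mul_mem_hilbertIdeal_of_posInv 1 hf

theorem mul_mem_hilbertIdeal (a : SymmetricAlgebra ℂ U) {f : SymmetricAlgebra ℂ U}
    (hf : f ∈ hilbertIdeal ρ N) : a * f ∈ hilbertIdeal ρ N := by
  refine Submodule.mul_induction_on hf (fun x _ y hy => ?_) fun x y hx hy => ?_
  · rw [← mul_assoc]; exact mul_mem_hilbertIdeal_of_posInv _ hy
  · rw [mul_add]; exact Submodule.add_mem _ hx hy

theorem symRep_comm {L : Type*} [Group L] {σ : Representation ℂ L U} {g : K} {l : L}
    (h : ∀ u, ρ g (σ l u) = σ l (ρ g u)) (f : SymmetricAlgebra ℂ U) :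
    symRep ρ g (symRep σ l f) = symRep σ l (symRep ρ g f) := by
  induction f using SymmetricAlgebra.induction with
  | algebraMap c => simp
  | ι u => simp [h]
  | mul a b ha hb => simp [ha, hb]
  | add a b ha hb => simp [ha, hb]

theorem dilation_symRep (ρ : Representation ℂ K U) (g : K) (f : SymmetricAlgebra ℂ U) :
    dilation U (symRep ρ g f) = symRep ρ g (dilation U f) :=
  (symRep_comm (by simp) f).symm

theorem isGraded_posInv (ρ : Representation ℂ K U) (N : Subgroup K) : IsGraded (posInv ρ N) :=
  fun f hf => ⟨fun n hn => by rw [← dilation_symRep, hf.1 n hn],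
    by rw [algebraMapInv_dilation, hf.2]⟩

theorem isGraded_hilbertIdeal (ρ : Representation ℂ K U) (N : Subgroup K) :
    IsGraded (hilbertIdeal ρ N) := isGraded_top.mul (isGraded_posInv ρ N)

theorem symRep_mem_posInv [N.Normal] (g : K) {f : SymmetricAlgebra ℂ U}
    (hf : f ∈ posInv ρ N) : symRep ρ g f ∈ posInv ρ N := by
  refine ⟨fun n hn => ?_, by rw [algebraMapInv_symRep, hf.2]⟩
  calc symRep ρ n (symRep ρ g f) = symRep ρ g (symRep ρ (g⁻¹ * n * g) f) := by
        rw [← Module.End.mul_apply, ← Module.End.mul_apply, ← map_mul, ← map_mul]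
        congr 2; group
    _ = symRep ρ g f := by
        rw [hf.1 _ (Subgroup.Normal.conj_mem' inferInstance n hn g)]

theorem symRep_mem_mul {M M' : Submodule ℂ (SymmetricAlgebra ℂ U)} (g : K)
    (hM : ∀ f ∈ M, symRep ρ g f ∈ M) (hM' : ∀ f ∈ M', symRep ρ g f ∈ M') :
    ∀ f ∈ M * M', symRep ρ g f ∈ M * M' := by
  intro f hf
  refine Submodule.mul_induction_on hf (fun a ha b hb => ?_) fun a b ha hb => ?_
  · rw [symRep_mul]
    exact Submodule.mul_mem_mul (hM a ha) (hM' b hb)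
  · rw [map_add]; exact Submodule.add_mem _ ha hb

theorem symRep_mem_hilbertIdeal [N.Normal] (g : K) {f : SymmetricAlgebra ℂ U}
    (hf : f ∈ hilbertIdeal ρ N) : symRep ρ g f ∈ hilbertIdeal ρ N :=
  symRep_mem_mul g (fun _ _ => Submodule.mem_top) (fun _ => symRep_mem_posInv g) f hf

/-- An automorphism of `U` that commutes with `N` preserves the `N`-harmonic polynomials. -/
theorem symRep_mem_harmonic_of_comm {L : Type*} [Group L] {σ : Representation ℂ L U} {l : L}
    (h : ∀ n ∈ N, ∀ u, ρ n (σ l u) = σ l (ρ n u)) {f : SymmetricAlgebra ℂ U}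
    (hf : f ∈ harmonic ρ N) : symRep σ l f ∈ harmonic ρ N := by
  intro p hp h0
  have e : symRep σ.dual l (symRep σ.dual l⁻¹ p) = p := by
    rw [← Module.End.mul_apply, ← map_mul, mul_inv_cancel, map_one, Module.End.one_apply]
  have key : diffOp (symRep σ.dual l⁻¹ p) f = 0 := by
    refine hf _ (fun n hn => ?_) (by rw [algebraMapInv_symRep, h0])
    rw [symRep_comm, hp n hn]
    intro ξ
    ext v
    have := h n⁻¹ (N.inv_mem hn) v
    simp [Dual.transpose_apply, this]
  rw [← e, diffOp_equivariant, key, map_zero]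

theorem isGraded_harmonic (ρ : Representation ℂ K U) (N : Subgroup K) :
    IsGraded (harmonic ρ N) := fun _ hf => symRep_mem_harmonic_of_comm (by simp) hf

/-- The orthogonal complement of the Hilbert ideal consists of the harmonic polynomials, since
multiplication by `q` is adjoint to the differential operator attached to the conjugate of `q`. -/
theorem polyOrth_hilbertIdeal {n : ℕ} {b : Basis (Fin n) ℂ U} {J : U →ₛₗ[starRingEnd ℂ] Dual ℂ U}
    (hJ : ∀ i, J (b i) = b.coord i) (hρ : ∀ g u, J (ρ g u) = ρ.dual g (J u)) :
    polyOrth b (hilbertIdeal ρ N) = harmonic ρ N := by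
  ext f
  constructor
  · intro hf p hp h0
    obtain ⟨q, rfl⟩ := conjDual_surjective (b := b) p
    have hq : q ∈ posInv ρ N := by
      refine ⟨fun g hg => conjDual_injective hJ ?_, ?_⟩
      · rw [conjDual_symRep hJ (hρ g), hp g hg]
      · rw [algebraMapInv_conjDual] at h0
        exact (map_eq_zero _).1 h0
    have h : diffOp (conjDual b q) f ∈ polyOrth b ⊤ := fun a _ => by
      rw [← polyForm_mul_left]
      exact hf _ (mul_mem_hilbertIdeal_of_posInv a hq)
    have := (isCompl_polyOrth hJ isGraded_top).disjoint.le_bot ⟨Submodule.mem_top, h⟩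
    exact (Submodule.mem_bot ℂ).1 this
  · intro hf a ha
    refine Submodule.mul_induction_on ha (fun x _ q hq => ?_) fun x y hx hy => ?_
    · rw [polyForm_mul_left, hf (conjDual b q) (fun g hg => by
        rw [← conjDual_symRep hJ (hρ g), hq.1 g hg]) (by
        rw [algebraMapInv_conjDual, hq.2, map_zero]), map_zero]
    · rw [map_add, LinearMap.add_apply, hx, hy, add_zero]

theorem isCompl_hilbertIdeal_harmonic [FiniteDimensional ℂ U] [Finite K]
    (ρ : Representation ℂ K U) (N : Subgroup K) :
    IsCompl (hilbertIdeal ρ N) (harmonic ρ N) := by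
  obtain ⟨n, b, J, hJ, hρ⟩ := exists_invariant_orthonormal_basis ρ
  rw [← polyOrth_hilbertIdeal hJ hρ]
  exact isCompl_polyOrth hJ (isGraded_hilbertIdeal ρ N)

/-- Maschke's theorem for graded subspaces of `S(U)`. -/
theorem exists_graded_stable_isCompl [FiniteDimensional ℂ U] [Finite K]
    (ρ : Representation ℂ K U) {W : Submodule ℂ (SymmetricAlgebra ℂ U)} (hW : IsGraded W)
    (hs : ∀ g, ∀ f ∈ W, symRep ρ g f ∈ W) :
    ∃ W' : Submodule ℂ (SymmetricAlgebra ℂ U), IsCompl W W' ∧ IsGraded W' ∧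
      ∀ g, ∀ f ∈ W', symRep ρ g f ∈ W' := by
  obtain ⟨n, b, J, hJ, hρ⟩ := exists_invariant_orthonormal_basis ρ
  refine ⟨polyOrth b W, isCompl_polyOrth hJ hW, isGraded_polyOrth hJ hW, fun g f hf a ha => ?_⟩
  have e : symRep ρ g (symRep ρ g⁻¹ a) = a := by
    rw [← Module.End.mul_apply, ← map_mul, mul_inv_cancel, map_one, Module.End.one_apply]
  rw [← e, polyForm_symRep hJ (hρ g)]
  exact hf _ (hs _ a ha)

end Hilbert

/-! ### Averaging over a finite group -/

section Average

variable {U : Type*} [AddCommGroup U] [Module ℂ U] {K : Type*} [Group K] [Finite K]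

open Classical in
/-- The mean of the translates of a polynomial under the elements of `N`. -/
noncomputable def avg (ρ : Representation ℂ K U) (N : Subgroup K) :
    Module.End ℂ (SymmetricAlgebra ℂ U) :=
  letI := Fintype.ofFinite N
  (Fintype.card N : ℂ)⁻¹ • ∑ n : N, symRep ρ n

variable (ρ : Representation ℂ K U) (N : Subgroup K)

theorem symRep_avg {n : K} (hn : n ∈ N) (f : SymmetricAlgebra ℂ U) :
    symRep ρ n (avg ρ N f) = avg ρ N f := by
  let := Fintype.ofFinite N
  simp only [avg, LinearMap.smul_apply, LinearMap.sum_apply, map_smul, map_sum]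
  congr 1
  refine Fintype.sum_equiv (Equiv.mulLeft (⟨n, hn⟩ : N)) _ _ fun m => ?_
  rw [← Module.End.mul_apply, ← map_mul]
  rfl

theorem avg_mul (f : SymmetricAlgebra ℂ U) {u : SymmetricAlgebra ℂ U}
    (hu : ∀ n ∈ N, symRep ρ n u = u) : avg ρ N (f * u) = avg ρ N f * u := by
  simp only [avg, LinearMap.smul_apply, LinearMap.sum_apply, smul_mul_assoc, Finset.sum_mul]
  congr 1
  exact Finset.sum_congr rfl fun n _ => by rw [symRep_mul, hu n n.2]

theorem avg_one : avg ρ N 1 = 1 := by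
  let := Fintype.ofFinite N
  have : (Fintype.card N : ℂ) ≠ 0 := by exact_mod_cast Fintype.card_ne_zero
  simp only [avg, LinearMap.smul_apply, LinearMap.sum_apply, symRep_one, Finset.sum_const,
    Finset.card_univ]
  rw [← Nat.cast_smul_eq_nsmul ℂ, smul_smul, inv_mul_cancel₀ this, one_smul]

theorem avg_eq_self {f : SymmetricAlgebra ℂ U} (hf : ∀ n ∈ N, symRep ρ n f = f) :
    avg ρ N f = f := by
  rw [← one_mul f, avg_mul ρ N 1 hf, avg_one]

theorem sub_avg_mem {M : Submodule ℂ (SymmetricAlgebra ℂ U)} {f : SymmetricAlgebra ℂ U}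
    (h : ∀ n ∈ N, f - symRep ρ n f ∈ M) : f - avg ρ N f ∈ M := by
  let := Fintype.ofFinite N
  have : (Fintype.card N : ℂ) ≠ 0 := by exact_mod_cast Fintype.card_ne_zero
  have e : f - avg ρ N f = (Fintype.card N : ℂ)⁻¹ • ∑ n : N, (f - symRep ρ n f) := by
    simp only [avg, LinearMap.smul_apply, LinearMap.sum_apply, Finset.sum_sub_distrib,
      Finset.sum_const, Finset.card_univ, smul_sub]
    rw [← Nat.cast_smul_eq_nsmul ℂ, smul_smul, inv_mul_cancel₀ this, one_smul]
  rw [e]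
  exact M.smul_mem _ (M.sum_mem fun n _ => h n n.2)

theorem algebraMapInv_avg (f : SymmetricAlgebra ℂ U) :
    SymmetricAlgebra.algebraMapInv (avg ρ N f) = SymmetricAlgebra.algebraMapInv f := by
  have : f - avg ρ N f ∈ LinearMap.ker
      (SymmetricAlgebra.algebraMapInv : SymmetricAlgebra ℂ U →ₐ[ℂ] ℂ).toLinearMap :=
    sub_avg_mem ρ N fun n _ => by simp [algebraMapInv_symRep]
  have := LinearMap.mem_ker.1 this
  rw [AlgHom.toLinearMap_apply, map_sub, sub_eq_zero] at this
  exact this.symm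

theorem avg_mem_posInv {f : SymmetricAlgebra ℂ U} (hf : SymmetricAlgebra.algebraMapInv f = 0) :
    avg ρ N f ∈ posInv ρ N :=
  ⟨fun _ hn => symRep_avg ρ N hn f, by rw [algebraMapInv_avg, hf]⟩

end Average

/-! ### Divided differences -/

section Demazure

open Module

variable {U : Type*} [AddCommGroup U] [Module ℂ U] {K : Type*} [Group K]

/-- The operator `ρ s` differs from the identity by an operator whose image lies in a line. -/
def FixesHyperplane (ρ : Representation ℂ K U) (s : K) : Prop :=
  ∃ α : U, α ≠ 0 ∧ ∀ u, u - ρ s u ∈ Submodule.span ℂ {α}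

variable {ρ : Representation ℂ K U}

theorem ι_ne_zero {α : U} (hα : α ≠ 0) : SymmetricAlgebra.ι ℂ U α ≠ 0 := by
  intro h
  apply hα
  rw [← Module.forall_dual_apply_eq_zero_iff ℂ]
  intro ξ
  have := congrArg (dirDeriv ξ) h
  rwa [dirDeriv_ι, map_zero, SymmetricAlgebra.algebraMap_eq_zero_iff] at this

theorem ι_dvd_sub_symRep {s : K} {α : U} (h : ∀ u, u - ρ s u ∈ Submodule.span ℂ {α})
    (f : SymmetricAlgebra ℂ U) : SymmetricAlgebra.ι ℂ U α ∣ f - symRep ρ s f := by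
  induction f using SymmetricAlgebra.induction with
  | algebraMap c => simp
  | ι u =>
    obtain ⟨c, hc⟩ := Submodule.mem_span_singleton.1 (h u)
    rw [symRep_ι, ← map_sub, ← hc, map_smul]
    exact ⟨algebraMap ℂ _ c, by rw [Algebra.smul_def, mul_comm]⟩
  | mul a b ha hb =>
    rw [symRep_mul, show a * b - symRep ρ s a * symRep ρ s b =
      (a - symRep ρ s a) * b + symRep ρ s a * (b - symRep ρ s b) by ring]
    exact dvd_add (ha.mul_right _) (hb.mul_left _)
  | add a b ha hb =>
    rw [map_add, add_sub_add_comm]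
    exact dvd_add ha hb

variable (ρ) in
/-- The linear operators on `S(U)` that are linear over the `N`-invariants and lower degrees by
`d`. -/
noncomputable def lowerOps (N : Subgroup K) (d : ℕ) :
    Submodule ℂ (Module.End ℂ (SymmetricAlgebra ℂ U)) where
  carrier := {D | (∀ u, (∀ n ∈ N, symRep ρ n u = u) → ∀ f, D (u * f) = u * D f) ∧
    ∀ f, D (dilation U f) = (2 : ℂ) ^ d • dilation U (D f)}
  zero_mem' := by simp
  add_mem' := fun {D D'} h h' => ⟨fun u hu f => by
      rw [LinearMap.add_apply, h.1 u hu, h'.1 u hu, ← mul_add, LinearMap.add_apply],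
    fun f => by
      rw [LinearMap.add_apply, h.2, h'.2, ← smul_add, ← map_add, LinearMap.add_apply]⟩
  smul_mem' := fun c D h => ⟨fun u hu f => by
      rw [LinearMap.smul_apply, h.1 u hu, LinearMap.smul_apply, mul_smul_comm],
    fun f => by
      rw [LinearMap.smul_apply, h.2, LinearMap.smul_apply, map_smul, smul_comm]⟩

variable {N : Subgroup K}

/-- The divided difference operator `f ↦ (f - s f) / α` of a reflection `s`. -/
theorem exists_dividedDifference {s : K} (hs : s ∈ N) (h : FixesHyperplane ρ s) :
    ∃ (α : U) (Δ : Module.End ℂ (SymmetricAlgebra ℂ U)), Δ ∈ lowerOps ρ N 1 ∧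
      ∀ f, SymmetricAlgebra.ι ℂ U α * Δ f = f - symRep ρ s f := by
  obtain ⟨α, hα, h⟩ := h
  have h0 := ι_ne_zero hα
  choose g hg using ι_dvd_sub_symRep h
  have cancel : ∀ {x y : SymmetricAlgebra ℂ U},
      SymmetricAlgebra.ι ℂ U α * x = SymmetricAlgebra.ι ℂ U α * y → x = y :=
    fun e => mul_left_cancel₀ h0 e
  let Δ : Module.End ℂ (SymmetricAlgebra ℂ U) :=
    { toFun := g
      map_add' := fun a b => cancel <| by
        rw [mul_add, ← hg, ← hg, ← hg, map_add, add_sub_add_comm]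
      map_smul' := fun c a => cancel <| by
        rw [← hg, RingHom.id_apply, mul_smul_comm, ← hg, map_smul, smul_sub] }
  have hΔ : ∀ f, SymmetricAlgebra.ι ℂ U α * Δ f = f - symRep ρ s f := fun f => (hg f).symm
  refine ⟨α, Δ, ⟨fun u hu f => cancel ?_, fun f => cancel ?_⟩, hΔ⟩
  · rw [hΔ, symRep_mul, hu s hs, ← mul_sub, ← hΔ]; ring
  · rw [hΔ, ← dilation_symRep, ← map_sub, ← hΔ, dilation_mul, dilation_ι, pow_one,
      smul_mul_assoc, mul_smul_comm]

theorem mul_mem_lowerOps {d e : ℕ} {D D' : Module.End ℂ (SymmetricAlgebra ℂ U)}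
    (hD : D ∈ lowerOps ρ N d) (hD' : D' ∈ lowerOps ρ N e) : D * D' ∈ lowerOps ρ N (d + e) :=
  ⟨fun u hu f => by
    rw [Module.End.mul_apply, hD'.1 u hu, hD.1 u hu, Module.End.mul_apply],
  fun f => by
    rw [Module.End.mul_apply, hD'.2, map_smul, hD.2, smul_smul, Module.End.mul_apply, pow_add,
      mul_comm]⟩

/-- An operator that lowers degrees by `d` maps degree `k` to degree `k - d`; here `k < d`. -/
theorem eq_zero_of_dilation_lower {d k : ℕ} (hk : k < d)
    {D : Module.End ℂ (SymmetricAlgebra ℂ U)}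
    (hD : ∀ f, D (dilation U f) = (2 : ℂ) ^ d • dilation U (D f)) {f : SymmetricAlgebra ℂ U}
    (hf : f ∈ homogeneousPart U k) : D f = 0 := by
  let M : Submodule ℂ (SymmetricAlgebra ℂ U) :=
    LinearMap.ker ((2 : ℂ) ^ d • dilation U - (2 : ℂ) ^ k • LinearMap.id)
  have mem : ∀ g, g ∈ M ↔ (2 : ℂ) ^ d • dilation U g = (2 : ℂ) ^ k • g := fun g => by
    simp [M, sub_eq_zero]
  have hM : M = ⊥ := by
    refine IsGraded.eq_bot (fun g hg => ?_) fun j g hg hj => ?_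
    · rw [mem] at hg ⊢
      rw [← map_smul, hg, map_smul]
    · rw [mem, mem_homogeneousPart_iff.1 hj, smul_smul, ← sub_eq_zero, ← sub_smul,
        smul_eq_zero] at hg
      refine hg.resolve_left fun h => ?_
      rw [sub_eq_zero, ← pow_add] at h
      have h' : (2 : ℕ) ^ (d + j) = 2 ^ k := by exact_mod_cast h
      have := Nat.pow_right_injective le_rfl h'
      omega
  have : D f ∈ M := by
    rw [mem, ← hD, mem_homogeneousPart_iff.1 hf, map_smul]
  rwa [hM] at this

theorem map_mem_homogeneousPart_zero {d : ℕ} {D : Module.End ℂ (SymmetricAlgebra ℂ U)}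
    (hD : ∀ f, D (dilation U f) = (2 : ℂ) ^ d • dilation U (D f)) {f : SymmetricAlgebra ℂ U}
    (hf : f ∈ homogeneousPart U d) : D f ∈ homogeneousPart U 0 := by
  have h := hD f
  rw [mem_homogeneousPart_iff.1 hf, map_smul] at h
  rw [mem_homogeneousPart_iff, pow_zero, one_smul]
  exact (smul_right_injective _ (pow_ne_zero d (two_ne_zero (α := ℂ))) h).symm

theorem sub_symRep_mem_hilbertIdeal [N.Normal]
    (hN : Subgroup.closure {s | s ∈ N ∧ FixesHyperplane ρ s} = N)
    {f : SymmetricAlgebra ℂ U}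
    (h : ∀ s ∈ N, FixesHyperplane ρ s → f - symRep ρ s f ∈ hilbertIdeal ρ N) :
    ∀ n ∈ N, f - symRep ρ n f ∈ hilbertIdeal ρ N := by
  intro n hn
  rw [← hN] at hn
  induction hn using Subgroup.closure_induction with
  | mem s hs => exact h s hs.1 hs.2
  | one => simp
  | mul a b _ _ ha hb =>
    rw [map_mul, Module.End.mul_apply, ← sub_add_sub_cancel f (symRep ρ a f), ← map_sub]
    exact Submodule.add_mem _ ha (symRep_mem_hilbertIdeal a hb)
  | inv a _ ha =>
    have := Submodule.neg_mem _ (symRep_mem_hilbertIdeal a⁻¹ ha)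
    rw [map_sub, ← Module.End.mul_apply, ← map_mul, inv_mul_cancel, map_one,
      Module.End.one_apply, neg_sub] at this
    exact this

/-- A homogeneous polynomial outside the Hilbert ideal of a reflection group is mapped to a
nonzero constant by some composition of divided differences. If all its divided differences were
in the ideal, it would be congruent to its average, which is in the ideal. -/
theorem exists_lowerOps_ne_zero [Finite K] [N.Normal]
    (hN : Subgroup.closure {s | s ∈ N ∧ FixesHyperplane ρ s} = N) {d : ℕ}
    {f : SymmetricAlgebra ℂ U} (hf : f ∈ homogeneousPart U d) (h : f ∉ hilbertIdeal ρ N) :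
    ∃ D ∈ lowerOps ρ N d, SymmetricAlgebra.algebraMapInv (D f) ≠ 0 := by
  induction d generalizing f with
  | zero =>
    refine ⟨1, ⟨fun _ _ _ => rfl, fun _ => by simp⟩, fun h0 => h ?_⟩
    rw [eq_zero_of_mem_homogeneousPart_zero hf h0]
    exact Submodule.zero_mem _
  | succ d ih =>
    obtain ⟨s, hs, hsα, hsf⟩ : ∃ s ∈ N, FixesHyperplane ρ s ∧
        f - symRep ρ s f ∉ hilbertIdeal ρ N := by
      by_contra! hc
      have h1 := sub_avg_mem ρ N (sub_symRep_mem_hilbertIdeal hN hc)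
      have h2 := posInv_le_hilbertIdeal
        (avg_mem_posInv ρ N (algebraMapInv_eq_zero_of_mem d.succ_ne_zero hf))
      exact h (by simpa using Submodule.add_mem _ h1 h2)
    obtain ⟨α, Δ, hΔ, e⟩ := exists_dividedDifference hs hsα
    have hd : Δ f ∈ homogeneousPart U d := by
      have := hΔ.2 f
      rw [mem_homogeneousPart_iff.1 hf, map_smul, pow_one, pow_succ', mul_smul] at this
      rw [mem_homogeneousPart_iff]
      exact (smul_right_injective _ (two_ne_zero (α := ℂ)) this).symm
    obtain ⟨D, hD, hDf⟩ := ih hd fun hc => hsf (e f ▸ mul_mem_hilbertIdeal _ hc)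
    exact ⟨D * Δ, mul_mem_lowerOps hD hΔ, hDf⟩

end Demazure

/-! ### Homogeneous bases and dual operators -/

section DualOps

open Module

variable {U : Type*} [AddCommGroup U] [Module ℂ U]

theorem exists_homogeneous_basis [FiniteDimensional ℂ U]
    {M : Submodule ℂ (SymmetricAlgebra ℂ U)} (hM : IsGraded M) :
    ∃ (n : ℕ → ℕ) (b : Basis (Σ d, Fin (n d)) ℂ M),
      ∀ i, (b i : SymmetricAlgebra ℂ U) ∈ homogeneousPart U i.1 := by
  classical
  let A : ℕ → Submodule ℂ M := fun d => (homogeneousPart U d).comap M.subtype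
  have hA : DirectSum.IsInternal A := by
    rw [DirectSum.isInternal_submodule_iff_iSupIndep_and_iSup_eq_top]
    constructor
    · refine ((iSupIndep_eigenspace_two_pow ((dilation U).restrict hM))).mono fun d f hf => ?_
      rw [Module.End.mem_eigenspace_iff]
      exact Subtype.ext (mem_homogeneousPart_iff.1 hf)
    · exact hM.iSup_comap_subtype
  have : ∀ d, FiniteDimensional ℂ (A d) := fun d =>
    Module.Finite.of_injective
      (((M.subtype ∘ₗ (A d).subtype).codRestrict (homogeneousPart U d)) fun x => x.2)
      fun x y h => Subtype.ext (Subtype.ext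
        (congrArg (fun z : homogeneousPart U d => (z : SymmetricAlgebra ℂ U)) h))
  have (d : ℕ) : Module.Free ℂ (A d) := Module.Free.of_divisionRing ℂ (A d)
  let c := fun d => Module.finBasis ℂ (A d)
  refine ⟨_, hA.collectedBasis c, fun i => ?_⟩
  exact hA.collectedBasis_mem _ i

/-- A space of operators whose constant terms separate a finite-dimensional space contains
operators dual to a basis. -/
theorem exists_dual_operator {ι : Type*} [Fintype ι] [DecidableEq ι]
    (b : ι → SymmetricAlgebra ℂ U)
    (L : Submodule ℂ (Module.End ℂ (SymmetricAlgebra ℂ U)))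
    (h : ∀ c : ι → ℂ, c ≠ 0 → ∃ D ∈ L, SymmetricAlgebra.algebraMapInv (D (∑ i, c i • b i)) ≠ 0)
    (i : ι) : ∃ D ∈ L, ∀ j, SymmetricAlgebra.algebraMapInv (D (b j)) = if j = i then 1 else 0 := by
  let Φ : L →ₗ[ℂ] (ι → ℂ) := LinearMap.pi fun j =>
    SymmetricAlgebra.algebraMapInv.toLinearMap ∘ₗ LinearMap.applyₗ (b j) ∘ₗ L.subtype
  have hΦ : ∀ D j, Φ D j = SymmetricAlgebra.algebraMapInv (D.1 (b j)) := fun _ _ => rfl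
  have htop : LinearMap.range Φ = ⊤ := by
    by_contra hne
    obtain ⟨φ, hφ, hle⟩ := Submodule.exists_le_ker_of_lt_top _ (lt_top_iff_ne_top.2 hne)
    obtain ⟨D, hD, hDc⟩ := h (fun j => φ (Pi.single j 1)) fun h0 => hφ <| by
      apply LinearMap.pi_ext'
      intro j
      ext
      simpa using congrFun h0 j
    apply hDc
    have := hle ⟨⟨D, hD⟩, rfl⟩
    rw [LinearMap.mem_ker, LinearMap.pi_apply_eq_sum_univ φ] at this
    simp only [map_sum, map_smul, smul_eq_mul]
    rw [← this]
    refine Finset.sum_congr rfl fun j _ => ?_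
    have e : (fun k => if j = k then (1 : ℂ) else 0) = Pi.single j 1 := by
      ext k; simp [Pi.single_apply, eq_comm]
    rw [hΦ, smul_eq_mul, mul_comm, e]
  obtain ⟨D, hD⟩ := LinearMap.range_eq_top.1 htop (fun j => if j = i then 1 else 0)
  exact ⟨D, D.2, fun j => by rw [← hΦ, hD]⟩

/-- Operators dual to a homogeneous basis, when those lowering the degree by `d` separate the
part of degree `d`. Such operators vanish on basis elements of smaller degree. -/
theorem exists_dual_lowering {M : Submodule ℂ (SymmetricAlgebra ℂ U)} {n : ℕ → ℕ}
    {b : Basis (Σ d, Fin (n d)) ℂ M}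
    (hb : ∀ i, (b i : SymmetricAlgebra ℂ U) ∈ homogeneousPart U i.1)
    (L : ℕ → Submodule ℂ (Module.End ℂ (SymmetricAlgebra ℂ U)))
    (hL : ∀ d, ∀ D ∈ L d, ∀ f, D (dilation U f) = (2 : ℂ) ^ d • dilation U (D f))
    (h : ∀ d, ∀ f ∈ M, f ∈ homogeneousPart U d → f ≠ 0 →
      ∃ D ∈ L d, SymmetricAlgebra.algebraMapInv (D f) ≠ 0) (i : Σ d, Fin (n d)) :
    ∃ D ∈ L i.1, D (b i) = 1 ∧ ∀ j, j.1 ≤ i.1 → j ≠ i → D (b j) = 0 := by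
  obtain ⟨d, k⟩ := i
  obtain ⟨D, hD, hDb⟩ := exists_dual_operator (fun k => (b ⟨d, k⟩ : SymmetricAlgebra ℂ U)) (L d)
    (fun c hc => by
      have e : ∑ i, c i • (b ⟨d, i⟩ : SymmetricAlgebra ℂ U) =
          ((∑ i, c i • b ⟨d, i⟩ : M) : SymmetricAlgebra ℂ U) := by simp
      refine h d _ (e ▸ Subtype.prop _) (Submodule.sum_mem _ fun i _ =>
        Submodule.smul_mem _ _ (hb ⟨d, i⟩)) fun h0 => hc ?_
      rw [e, Submodule.coe_eq_zero] at h0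
      have li := b.linearIndependent.comp (fun i : Fin (n d) => (⟨d, i⟩ : Σ d, Fin (n d)))
        fun x y h => by simpa using h
      exact funext (Fintype.linearIndependent_iff.1 li c h0)) k
  have hc : ∀ j, D (b ⟨d, j⟩) = algebraMap ℂ _ (if j = k then 1 else 0) := fun j => by
    obtain ⟨c, hc⟩ :=
      mem_homogeneousPart_zero.1 (map_mem_homogeneousPart_zero (hL d D hD) (hb ⟨d, j⟩))
    rw [← hDb, ← hc, SymmetricAlgebra.algebraMap_leftInverse]
  refine ⟨D, hD, by rw [hc]; simp, ?_⟩
  rintro ⟨e, j⟩ hle hne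
  rcases hle.lt_or_eq with hlt | heq
  · exact eq_zero_of_dilation_lower hlt (hL d D hD) (hb ⟨e, j⟩)
  · dsimp only at heq
    subst heq
    rw [hc, if_neg, map_zero]
    rintro rfl
    exact hne rfl

end DualOps

/-! ### Polynomials as a module over the invariants -/

section Chevalley

open Module

variable {U : Type*} [AddCommGroup U] [Module ℂ U] {K : Type*} [Group K]

/-- The algebra of `N`-invariant polynomials. -/
noncomputable def invAlg (ρ : Representation ℂ K U) (N : Subgroup K) :
    Subalgebra ℂ (SymmetricAlgebra ℂ U) where
  carrier := {f | ∀ n ∈ N, symRep ρ n f = f}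
  mul_mem' := fun ha hb n hn => by rw [symRep_mul, ha n hn, hb n hn]
  add_mem' := fun ha hb n hn => by rw [map_add, ha n hn, hb n hn]
  algebraMap_mem' := fun c n _ => symRep_algebraMap _ _ _

variable {ρ : Representation ℂ K U} {N : Subgroup K}

theorem mem_invAlg {f : SymmetricAlgebra ℂ U} :
    f ∈ invAlg ρ N ↔ ∀ n ∈ N, symRep ρ n f = f := Iff.rfl

theorem isGraded_invAlg (ρ : Representation ℂ K U) (N : Subgroup K) :
    IsGraded (Subalgebra.toSubmodule (invAlg ρ N)) := fun f hf n hn => by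
  rw [← dilation_symRep, hf n hn]

theorem posInv_inf_homogeneousPart_zero (ρ : Representation ℂ K U) (N : Subgroup K) :
    posInv ρ N ⊓ homogeneousPart U 0 = ⊥ := by
  rw [eq_bot_iff]
  exact fun f hf => eq_zero_of_mem_homogeneousPart_zero hf.2 hf.1.2

theorem IsGraded.sup_inf_le {M M' : Submodule ℂ (SymmetricAlgebra ℂ U)} (hM : IsGraded M)
    (hM' : IsGraded M') (d : ℕ) :
    (M ⊔ M') ⊓ homogeneousPart U d ≤ M ⊓ homogeneousPart U d ⊔ M' ⊓ homogeneousPart U d := by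
  rintro f ⟨hf, hd⟩
  refine mem_of_mem_iSup_of_mem_homogeneousPart
    (Y := fun d => M ⊓ homogeneousPart U d ⊔ M' ⊓ homogeneousPart U d)
    (fun k => sup_le inf_le_right inf_le_right) ?_ hd
  rw [iSup_sup_eq]
  exact sup_le_sup hM.le_iSup hM'.le_iSup hf

/-- The graded Nakayama lemma for `S(U)` over the `N`-invariants. -/
theorem eq_top_of_harmonic_le [FiniteDimensional ℂ U] [Finite K]
    {M : Submodule ℂ (SymmetricAlgebra ℂ U)} (h : harmonic ρ N ≤ M)
    (hM : ∀ a ∈ M, ∀ g ∈ posInv ρ N, a * g ∈ M) : M = ⊤ := by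
  rw [eq_top_iff, ← iSup_homogeneousPart]
  refine iSup_le fun d => ?_
  induction d using Nat.strong_induction_on with
  | _ d ih =>
    have hI := isGraded_hilbertIdeal ρ N
    have h1 := hI.sup_inf_le (isGraded_harmonic ρ N) d
    rw [(isCompl_hilbertIdeal_harmonic ρ N).sup_eq_top, top_inf_eq] at h1
    refine h1.trans (sup_le ?_ (inf_le_left.trans h))
    refine (isGraded_top.mul_inf_le (isGraded_posInv ρ N) d).trans
      (iSup₂_le fun p hp => Submodule.mul_le.2 fun a ha g hg => ?_)
    rw [Finset.HasAntidiagonal.mem_antidiagonal] at hp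
    rcases Nat.eq_zero_or_pos p.2 with h0 | hpos
    · rw [h0, posInv_inf_homogeneousPart_zero, Submodule.mem_bot] at hg
      rw [hg, mul_zero]
      exact M.zero_mem
    · exact hM a (ih p.1 (by omega) ha.2) g hg.1

theorem lowerOps_mem_hilbertIdeal {N' : Subgroup K} (hle : N ≤ N') {d : ℕ}
    {D : Module.End ℂ (SymmetricAlgebra ℂ U)} (hD : D ∈ lowerOps ρ N d)
    {f : SymmetricAlgebra ℂ U} (hf : f ∈ hilbertIdeal ρ N') : D f ∈ hilbertIdeal ρ N' := by
  refine Submodule.mul_induction_on hf (fun a _ g hg => ?_) fun a b ha hb => ?_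
  · rw [mul_comm, hD.1 g fun n hn => hg.1 n (hle hn), mul_comm]
    exact mul_mem_hilbertIdeal_of_posInv _ hg
  · rw [map_add]; exact Submodule.add_mem _ ha hb

/-- The harmonic polynomials of a reflection group `N` are independent over the `N`-invariants,
even modulo the Hilbert ideal of a larger group. A coefficient of top degree is isolated by an
operator dual to the corresponding basis element. -/
theorem coeff_mem_hilbertIdeal [FiniteDimensional ℂ U] [Finite K] [N.Normal]
    (hN : Subgroup.closure {s | s ∈ N ∧ FixesHyperplane ρ s} = N) {N' : Subgroup K} (hle : N ≤ N')
    {n : ℕ → ℕ} {b : Basis (Σ d, Fin (n d)) ℂ (harmonic ρ N)}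
    (hb : ∀ i, (b i : SymmetricAlgebra ℂ U) ∈ homogeneousPart U i.1)
    (T : Finset (Σ d, Fin (n d))) {c : (Σ d, Fin (n d)) → SymmetricAlgebra ℂ U}
    (hc : ∀ i, c i ∈ invAlg ρ N) (h : ∑ i ∈ T, c i * b i ∈ hilbertIdeal ρ N') :
    ∀ i ∈ T, c i ∈ hilbertIdeal ρ N' := by
  classical
  by_contra! hex
  set T' := T.filter fun i => c i ∉ hilbertIdeal ρ N' with hT'
  have hne : T'.Nonempty := by
    obtain ⟨i, hi, hi'⟩ := hex
    exact ⟨i, Finset.mem_filter.2 ⟨hi, hi'⟩⟩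
  obtain ⟨i, hi, hmax⟩ := T'.exists_max_image (fun i => i.1) hne
  obtain ⟨D, hD, hDi, hDj⟩ := exists_dual_lowering hb (lowerOps ρ N) (fun _ _ h => h.2)
    (fun d f hf hd hf0 => exists_lowerOps_ne_zero hN hd fun hI => hf0 <|
      (Submodule.mem_bot ℂ).1
        ((isCompl_hilbertIdeal_harmonic ρ N).disjoint.le_bot ⟨hI, hf⟩)) i
  have h' : ∑ i ∈ T', c i * b i ∈ hilbertIdeal ρ N' := by
    rw [← Finset.sum_filter_add_sum_filter_not T fun i => c i ∉ hilbertIdeal ρ N'] at h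
    refine (Submodule.add_mem_iff_left _ (Submodule.sum_mem _ fun j hj => ?_)).1 h
    rw [mul_comm]
    exact mul_mem_hilbertIdeal _ (not_not.1 (Finset.mem_filter.1 hj).2)
  have key := lowerOps_mem_hilbertIdeal hle hD h'
  rw [map_sum, Finset.sum_eq_single_of_mem i hi fun j hj hji => by
    rw [hD.1 _ (hc j), hDj j (hmax j hj) hji, mul_zero], hD.1 _ (hc i), hDi, mul_one] at key
  exact (Finset.mem_filter.1 hi).2 key

/-! ### Algebraically independent generators of the invariants -/

/-- The linear operators on `S(U)` that restrict to a derivation on the `N`-invariants and lower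
degrees by `d`. -/
noncomputable def invDers (ρ : Representation ℂ K U) (N : Subgroup K) (d : ℕ) :
    Submodule ℂ (Module.End ℂ (SymmetricAlgebra ℂ U)) where
  carrier := {D | (∀ u ∈ invAlg ρ N, ∀ v ∈ invAlg ρ N, D (u * v) = u * D v + v * D u) ∧
    ∀ f, D (dilation U f) = (2 : ℂ) ^ d • dilation U (D f)}
  zero_mem' := by simp
  add_mem' := fun {D D'} h h' => ⟨fun u hu v hv => by
      simp only [LinearMap.add_apply, h.1 u hu v hv, h'.1 u hu v hv]; ring,
    fun f => by
      rw [LinearMap.add_apply, h.2, h'.2, ← smul_add, ← map_add, LinearMap.add_apply]⟩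
  smul_mem' := fun c D h => ⟨fun u hu v hv => by
      simp only [LinearMap.smul_apply, h.1 u hu v hv, smul_add, mul_smul_comm],
    fun f => by
      rw [LinearMap.smul_apply, h.2, LinearMap.smul_apply, map_smul, smul_comm]⟩

theorem mul_dirDeriv_mem_invDers {d : ℕ} {D : Module.End ℂ (SymmetricAlgebra ℂ U)}
    (hD : D ∈ lowerOps ρ N d) (ξ : Dual ℂ U) :
    D ∘ₗ (dirDeriv ξ : SymmetricAlgebra ℂ U →ₗ[ℂ] SymmetricAlgebra ℂ U) ∈
      invDers ρ N (d + 1) := by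
  refine ⟨fun u hu v hv => ?_, fun f => ?_⟩
  · simp only [LinearMap.comp_apply, Derivation.coeFn_coe, Derivation.leibniz, smul_eq_mul,
      map_add, hD.1 u hu, hD.1 v hv]
  · simp only [LinearMap.comp_apply, Derivation.coeFn_coe, dirDeriv_dilation, map_smul, hD.2,
      smul_smul, pow_succ']

theorem map_aeval_eq_sum_pderiv {τ : Type*} [Fintype τ] {b : τ → SymmetricAlgebra ℂ U}
    (hb : ∀ i, b i ∈ invAlg ρ N) {D : Module.End ℂ (SymmetricAlgebra ℂ U)}
    (hD : ∀ u ∈ invAlg ρ N, ∀ v ∈ invAlg ρ N, D (u * v) = u * D v + v * D u)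
    (p : MvPolynomial τ ℂ) :
    D (MvPolynomial.aeval b p) =
      ∑ i, MvPolynomial.aeval b (MvPolynomial.pderiv i p) * D (b i) := by
  classical
  have hmem : ∀ p : MvPolynomial τ ℂ, MvPolynomial.aeval b p ∈ invAlg ρ N := fun p => by
    induction p using MvPolynomial.induction_on with
    | C c => rw [MvPolynomial.aeval_C]; exact Subalgebra.algebraMap_mem _ c
    | add p q hp hq => rw [map_add]; exact add_mem hp hq
    | mul_X p i hp => rw [map_mul, MvPolynomial.aeval_X]; exact mul_mem hp (hb i)
  have h1 : D 1 = 0 := by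
    have := hD 1 (one_mem _) 1 (one_mem _)
    simpa using this
  induction p using MvPolynomial.induction_on with
  | C c => simp [Algebra.algebraMap_eq_smul_one, h1]
  | add p q hp hq => simp only [map_add, hp, hq, add_mul, Finset.sum_add_distrib]
  | mul_X p i hp =>
    rw [map_mul, MvPolynomial.aeval_X, hD _ (hmem p) _ (hb i), hp]
    simp only [Derivation.leibniz, smul_eq_mul, map_add, map_mul, MvPolynomial.aeval_X, add_mul,
      Finset.sum_add_distrib, MvPolynomial.pderiv_X]
    congr 1
    · rw [Finset.sum_eq_single i]
      · simp
      · intro j _ hj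
        simp [hj.symm]
      · simp
    · rw [Finset.mul_sum]
      exact Finset.sum_congr rfl fun j _ => by ring

/-- Invariants with dual derivations of the algebra of invariants are algebraically independent:
the relations are closed under partial derivatives, hence contain a nonzero constant if they
contain a nonzero polynomial. -/
theorem algebraicIndependent_of_invDers {τ : Type*} [Fintype τ] {b : τ → SymmetricAlgebra ℂ U}
    (hb : ∀ i, b i ∈ posInv ρ N) (deg : τ → ℕ)
    (h : ∀ i, ∃ d, ∃ D ∈ invDers ρ N d, D (b i) = 1 ∧ ∀ j, deg j ≤ deg i → j ≠ i → D (b j) = 0) :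
    AlgebraicIndependent ℂ b := by
  classical
  have hb' : ∀ i, b i ∈ invAlg ρ N := fun i => (hb i).1
  have hp : ∀ p : MvPolynomial τ ℂ, MvPolynomial.aeval b p = 0 →
      ∀ i, MvPolynomial.aeval b (MvPolynomial.pderiv i p) = 0 := by
    intro p hp
    by_contra! hex
    obtain ⟨i, hi, hmax⟩ := (Finset.univ.filter fun i =>
      MvPolynomial.aeval b (MvPolynomial.pderiv i p) ≠ 0).exists_max_image deg
        (by obtain ⟨i, hi⟩ := hex; exact ⟨i, by simpa using hi⟩)
    obtain ⟨d, D, hD, hDi, hDj⟩ := h i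
    have e := map_aeval_eq_sum_pderiv hb' hD.1 p
    rw [hp, map_zero, Finset.sum_eq_single i, hDi, mul_one] at e
    · exact (Finset.mem_filter.1 hi).2 e.symm
    · intro j _ hji
      by_cases hj : MvPolynomial.aeval b (MvPolynomial.pderiv j p) = 0
      · rw [hj, zero_mul]
      · rw [hDj j (hmax j (by simpa using hj)) hji, mul_zero]
    · simp
  have hcoeff : ∀ (k : ℕ) (m : τ →₀ ℕ), m.degree = k → ∀ p : MvPolynomial τ ℂ,
      MvPolynomial.aeval b p = 0 → p.coeff m = 0 := by
    intro k
    induction k with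
    | zero =>
      intro m hm p hp
      have e := MvPolynomial.comp_aeval_apply b SymmetricAlgebra.algebraMapInv p
      rw [hp, map_zero,
        show (fun i => SymmetricAlgebra.algebraMapInv (b i)) = 0 from funext fun i => (hb i).2,
        MvPolynomial.aeval_zero] at e
      rw [(Finsupp.degree_eq_zero_iff m).1 hm]
      simpa [MvPolynomial.constantCoeff_eq] using e.symm
    | succ k ih =>
      intro m hm p hp0
      obtain ⟨i, hi⟩ : ∃ i, m i ≠ 0 := by
        by_contra! h0
        rw [(Finsupp.degree_eq_zero_iff m).2 (Finsupp.ext h0)] at hm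
        omega
      obtain ⟨m', rfl⟩ : ∃ m', m = m' + Finsupp.single i 1 :=
        ⟨m - Finsupp.single i 1, (tsub_add_cancel_of_le
          (Finsupp.single_le_iff.2 (Nat.one_le_iff_ne_zero.2 hi))).symm⟩
      have hm' : m'.degree = k := by simpa using hm
      have := ih m' hm' _ (hp p hp0 i)
      rw [MvPolynomial.coeff_pderiv] at this
      exact (mul_eq_zero.1 this).resolve_right (by exact_mod_cast (m' i).succ_ne_zero)
  rw [algebraicIndependent_iff]
  intro p hp
  ext m
  rw [hcoeff _ m rfl p hp, MvPolynomial.coeff_zero]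

end Chevalley

section Generators

open Module

variable {U : Type*} [AddCommGroup U] [Module ℂ U] {K : Type*} [Group K]
  {ρ : Representation ℂ K U} {N : Subgroup K}

theorem isIntegral_invAlg [Finite K] (ρ : Representation ℂ K U) (N : Subgroup K) :
    Algebra.IsIntegral (invAlg ρ N) (SymmetricAlgebra ℂ U) := by
  let : MulSemiringAction N (SymmetricAlgebra ℂ U) :=
    { smul := fun n f => symRep ρ n f
      one_smul := fun f => by change symRep ρ (1 : N) f = f; simp
      mul_smul := fun a b f => by
        change symRep ρ (a * b : N) f = symRep ρ a (symRep ρ b f); simp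
      smul_zero := fun _ => map_zero _
      smul_add := fun _ _ _ => map_add _ _ _
      smul_one := fun _ => symRep_one _ _
      smul_mul := fun _ _ _ => symRep_mul _ _ _ _ }
  have : Algebra.IsInvariant (invAlg ρ N) (SymmetricAlgebra ℂ U) N :=
    ⟨fun f hf => ⟨⟨f, fun n hn => hf ⟨n, hn⟩⟩, rfl⟩⟩
  exact Algebra.IsInvariant.isIntegral _ _ N

/-- The average of the product of a polynomial without constant term and an element of the Hilbert
ideal is a decomposable invariant. -/
theorem avg_mul_mem_posInv_mul [Finite K] {x f : SymmetricAlgebra ℂ U}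
    (hx : SymmetricAlgebra.algebraMapInv x = 0) (hf : f ∈ hilbertIdeal ρ N) :
    avg ρ N (x * f) ∈ posInv ρ N * posInv ρ N := by
  refine Submodule.mul_induction_on hf (fun a _ g hg => ?_) fun a b ha hb => ?_
  · rw [← mul_assoc, avg_mul ρ N _ hg.1]
    exact Submodule.mul_mem_mul (avg_mem_posInv ρ N (by rw [map_mul, hx, zero_mul])) hg
  · rw [mul_add, map_add]; exact Submodule.add_mem _ ha hb

/-- An indecomposable homogeneous invariant of a reflection group is mapped to a nonzero constant
by a derivation of the algebra of invariants. By Euler's identity, if all its partial derivatives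
were in the Hilbert ideal, it would be decomposable. -/
theorem exists_invDers_ne_zero [FiniteDimensional ℂ U] [Finite K] [N.Normal]
    (hN : Subgroup.closure {s | s ∈ N ∧ FixesHyperplane ρ s} = N) {d : ℕ}
    {f : SymmetricAlgebra ℂ U} (hd : f ∈ homogeneousPart U d) (hf : f ∈ posInv ρ N)
    (hf' : f ∉ posInv ρ N * posInv ρ N) :
    ∃ D ∈ invDers ρ N d, SymmetricAlgebra.algebraMapInv (D f) ≠ 0 := by
  rcases d with _ | d
  · rw [eq_zero_of_mem_homogeneousPart_zero hd hf.2] at hf'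
    exact absurd (Submodule.zero_mem _) hf'
  obtain ⟨ξ, hξ⟩ : ∃ ξ, dirDeriv ξ f ∉ hilbertIdeal ρ N := by
    by_contra! h
    let b := Module.finBasis ℂ U
    have e := congrArg (avg ρ N) (sum_basis_mul_dirDeriv b hd)
    rw [map_smul, avg_eq_self ρ N hf.1, map_sum] at e
    have h0 : ((d + 1 : ℕ) : ℂ) ≠ 0 := by exact_mod_cast d.succ_ne_zero
    refine hf' ((Submodule.smul_mem_iff _ h0).1 (e ▸ Submodule.sum_mem _ fun i _ => ?_))
    exact avg_mul_mem_posInv_mul (SymmetricAlgebra.algebraMapInv_ι _) (h _)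
  obtain ⟨D, hD, hDf⟩ := exists_lowerOps_ne_zero hN (dirDeriv_mem_homogeneousPart ξ hd) hξ
  exact ⟨_, mul_dirDeriv_mem_invDers hD ξ, hDf⟩

/-- A graded complement of the decomposable invariants generates the algebra of invariants. -/
theorem invAlg_le_of_posInv_le {E : Submodule ℂ (SymmetricAlgebra ℂ U)} (hE : IsGraded E)
    (h : posInv ρ N ≤ posInv ρ N * posInv ρ N ⊔ E)
    {A : Subalgebra ℂ (SymmetricAlgebra ℂ U)} (hA : E ≤ Subalgebra.toSubmodule A) :
    invAlg ρ N ≤ A := by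
  have key : ∀ d, ∀ f ∈ invAlg ρ N, f ∈ homogeneousPart U d → f ∈ A := by
    intro d
    induction d using Nat.strong_induction_on with
    | _ d ih =>
      intro f hf hd
      rcases Nat.eq_zero_or_pos d with rfl | hpos
      · obtain ⟨c, rfl⟩ := mem_homogeneousPart_zero.1 hd
        exact A.algebraMap_mem c
      have hP := isGraded_posInv ρ N
      have hfP : f ∈ posInv ρ N := ⟨hf, algebraMapInv_eq_zero_of_mem hpos.ne' hd⟩
      have hs := (hP.mul hP).sup_inf_le hE d ⟨h hfP, hd⟩
      suffices hle : posInv ρ N * posInv ρ N ⊓ homogeneousPart U d ≤ Subalgebra.toSubmodule A from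
        sup_le hle (inf_le_left.trans hA) hs
      refine (hP.mul_inf_le hP d).trans
        (iSup₂_le fun p hp => Submodule.mul_le.2 fun a ha g hg => ?_)
      rw [Finset.HasAntidiagonal.mem_antidiagonal] at hp
      rcases Nat.eq_zero_or_pos p.1 with h1 | h1
      · rw [h1, posInv_inf_homogeneousPart_zero, Submodule.mem_bot] at ha
        rw [ha, zero_mul]; exact zero_mem _
      rcases Nat.eq_zero_or_pos p.2 with h2 | h2
      · rw [h2, posInv_inf_homogeneousPart_zero, Submodule.mem_bot] at hg
        rw [hg, mul_zero]; exact zero_mem _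
      exact A.mul_mem (ih p.1 (by omega) a ha.1.1 ha.2) (ih p.2 (by omega) g hg.1.1 hg.2)
  have hle : Subalgebra.toSubmodule (invAlg ρ N) ≤ Subalgebra.toSubmodule A :=
    (isGraded_invAlg ρ N).le key
  exact hle

/-- Chevalley's theorem, with generators whose span is stable under a group normalizing the
reflection group. -/
theorem exists_stable_generators [FiniteDimensional ℂ U] [Finite K] [N.Normal]
    (hN : Subgroup.closure {s | s ∈ N ∧ FixesHyperplane ρ s} = N) {r : ℕ}
    (hr : finrank ℂ U = r) :
    ∃ f : Fin r → SymmetricAlgebra ℂ U,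
      (∀ i, ∃ d, f i ∈ homogeneousPart U d) ∧ AlgebraicIndependent ℂ f ∧
      Algebra.adjoin ℂ (Set.range f) = invAlg ρ N ∧
      ∀ g, Submodule.span ℂ (Set.range f) ≤
        (Submodule.span ℂ (Set.range f)).comap (symRep ρ g) := by
  classical
  have hP := isGraded_posInv ρ N
  have hPs : ∀ g, ∀ f ∈ posInv ρ N, symRep ρ g f ∈ posInv ρ N := fun g f => symRep_mem_posInv g
  obtain ⟨E₀, hcompl, hE₀, hE₀s⟩ := exists_graded_stable_isCompl ρ (hP.mul hP)
    fun g => symRep_mem_mul g (hPs g) (hPs g)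
  have hPP : posInv ρ N * posInv ρ N ≤ posInv ρ N := Submodule.mul_le.2 fun a ha b hb =>
    ⟨fun n hn => by rw [symRep_mul, ha.1 n hn, hb.1 n hn], by rw [map_mul, ha.2, zero_mul]⟩
  let E := E₀ ⊓ posInv ρ N
  have hE : IsGraded E := hE₀.inf hP
  have hle : posInv ρ N ≤ posInv ρ N * posInv ρ N ⊔ E := by
    rw [← sup_inf_assoc_of_le _ hPP, hcompl.sup_eq_top, top_inf_eq]
  obtain ⟨n, b, hb⟩ := exists_homogeneous_basis hE
  let f : (Σ d, Fin (n d)) → SymmetricAlgebra ℂ U := fun i => b i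
  have hspan : Submodule.span ℂ (Set.range f) = E := by
    have : Set.range f = E.subtype '' Set.range b := by
      rw [← Set.range_comp]; rfl
    rw [this, Submodule.span_image, b.span_eq, Submodule.map_subtype_top]
  have hind : AlgebraicIndependent ℂ f := by
    refine algebraicIndependent_of_finite_type fun t ht => ?_
    have := ht.fintype
    refine algebraicIndependent_of_invDers (ρ := ρ) (N := N) (fun i => (b i).2.2)
      (fun i => i.1.1) fun i => ?_
    obtain ⟨D, hD, hDi, hDj⟩ := exists_dual_lowering hb (invDers ρ N) (fun _ _ h => h.2)
      (fun d f hf hd hf0 => exists_invDers_ne_zero hN hd hf.2 fun hI => hf0 <|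
        (Submodule.mem_bot ℂ).1 (hcompl.disjoint.le_bot ⟨hI, hf.1⟩)) i.1
    exact ⟨_, D, hD, hDi, fun j hj hne => hDj j hj fun h => hne (Subtype.ext h)⟩
  have hadj : Algebra.adjoin ℂ (Set.range f) = invAlg ρ N := by
    apply le_antisymm
    · rw [Algebra.adjoin_le_iff]
      rintro _ ⟨i, rfl⟩
      exact (b i).2.2.1
    · refine invAlg_le_of_posInv_le hE hle ?_
      rw [← hspan]
      exact Algebra.span_le_adjoin ℂ _
  have htb : IsTranscendenceBasis ℂ f := by
    have := isIntegral_invAlg ρ N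
    rw [hind.isTranscendenceBasis_iff_isAlgebraic, hadj]
    infer_instance
  have hcard := htb.lift_cardinalMk_eq ((SymmetricAlgebra.equivMvPolynomial
    (Module.finBasis ℂ U)).symm.isTranscendenceBasis (IsTranscendenceBasis.mvPolynomial _ ℂ))
  subst hr
  obtain ⟨e⟩ := Cardinal.lift_mk_eq'.1 hcard
  have hrange : Set.range (f ∘ e.symm) = Set.range f := e.symm.surjective.range_comp f
  refine ⟨f ∘ e.symm, fun i => ⟨_, hb _⟩, hind.comp _ e.symm.injective, by rw [hrange, hadj],
    fun g => ?_⟩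
  rw [hrange, hspan]
  exact fun x hx => ⟨hE₀s g x hx.1, hPs g x hx.2⟩

end Generators

/-! ### Reflection groups and their stable invariants -/

section ReflectionGroup

open Module

variable {V : Type*} [AddCommGroup V] [Module ℂ V] {G : Subgroup (LinearMap.GeneralLinearGroup ℂ V)}

theorem dualRep_apply (g : G) (ξ : Dual ℂ V) (v : V) :
    dualRep G g ξ v = ξ ((((g⁻¹ : G) : LinearMap.GeneralLinearGroup ℂ V) : V →ₗ[ℂ] V) v) := rfl

theorem fixesHyperplane_dualRep [FiniteDimensional ℂ V] {s : G}
    (hs : IsReflection (s : LinearMap.GeneralLinearGroup ℂ V)) :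
    FixesHyperplane (dualRep G) s := by
  obtain ⟨-, W, hW, hfix⟩ := hs
  have h1 : finrank ℂ W.dualAnnihilator = 1 := by
    have := Subspace.finrank_add_finrank_dualAnnihilator_eq W
    omega
  obtain ⟨⟨α, hα⟩, hne, hspan⟩ := finrank_eq_one_iff'.1 h1
  refine ⟨α, fun h => hne (Subtype.ext h), fun ξ => ?_⟩
  have hmem : ξ - dualRep G s ξ ∈ W.dualAnnihilator := by
    rw [Submodule.mem_dualAnnihilator]
    intro w hw
    have : (((s⁻¹ : G) : LinearMap.GeneralLinearGroup ℂ V) : V →ₗ[ℂ] V) w = w := by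
      conv_lhs => rw [← hfix w hw]
      rw [Subgroup.coe_inv]
      exact LinearMap.congr_fun (Units.inv_mul (s : LinearMap.GeneralLinearGroup ℂ V)) w
    rw [LinearMap.sub_apply, dualRep_apply, this, sub_self]
  obtain ⟨c, hc⟩ := hspan ⟨_, hmem⟩
  exact Submodule.mem_span_singleton.2 ⟨c, congrArg Subtype.val hc⟩

theorem closure_fixesHyperplane [FiniteDimensional ℂ V] {N : Subgroup G}
    (hN : IsReflectionGroup (N.map G.subtype)) :
    Subgroup.closure {s | s ∈ N ∧ FixesHyperplane (dualRep G) s} = N := by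
  apply le_antisymm
  · rw [Subgroup.closure_le]
    exact fun s hs => hs.1
  · rw [← Subgroup.map_le_map_iff_of_injective G.subtype_injective, MonoidHom.map_closure]
    conv_lhs => rw [← hN.2]
    refine Subgroup.closure_mono ?_
    rintro _ ⟨⟨s, hs, rfl⟩, hr⟩
    exact ⟨s, ⟨hs, fixesHyperplane_dualRep hr⟩, rfl⟩

theorem nonempty_stableInvariants [FiniteDimensional ℂ V] [Finite G] (N : Subgroup G) [N.Normal]
    (hN : IsReflectionGroup (N.map G.subtype)) : Nonempty (StableInvariants N) := by
  obtain ⟨f, hf, hind, hadj, hs⟩ := exists_stable_generators (closure_fixesHyperplane hN)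
    (r := finrank ℂ V) Subspace.dual_finrank_eq
  exact ⟨⟨f, hf, hind, fun p => by rw [hadj]; rfl, hs⟩⟩

end ReflectionGroup

/-! ### Polynomials on the orbit space -/

namespace StableInvariants

open Module

variable {V : Type*} [AddCommGroup V] [Module ℂ V] {G : Subgroup (LinearMap.GeneralLinearGroup ℂ V)}
  {N : Subgroup G} (B : StableInvariants N)

instance : FiniteDimensional ℂ B.Edual := FiniteDimensional.span_of_finite ℂ (Set.finite_range _)

@[simp] theorem toPoly_ι (x : B.Edual) : B.toPoly (SymmetricAlgebra.ι ℂ _ x) = x := by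
  simp [toPoly]

/-- The fundamental invariants, as a basis of their span. -/
noncomputable def basis : Basis (Fin (finrank ℂ V)) ℂ B.Edual :=
  Basis.span B.algebraicIndependent.linearIndependent

@[simp] theorem coe_basis (i : Fin (finrank ℂ V)) :
    (B.basis i : SymmetricAlgebra ℂ (Dual ℂ V)) = B.inv i :=
  congrArg Subtype.val (Basis.span_apply _ i)

theorem toPoly_eq (c : SymmetricAlgebra ℂ B.Edual) :
    B.toPoly c = MvPolynomial.aeval B.inv (SymmetricAlgebra.equivMvPolynomial B.basis c) := by
  have : B.toPoly = (MvPolynomial.aeval B.inv).comp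
      (SymmetricAlgebra.equivMvPolynomial B.basis).toAlgHom := by
    apply SymmetricAlgebra.algHom_ext
    apply B.basis.ext
    intro i
    simp
  rw [this]
  rfl

theorem toPoly_injective : Function.Injective B.toPoly := by
  have h : Function.Injective (MvPolynomial.aeval B.inv) := B.algebraicIndependent
  intro x y hxy
  rw [toPoly_eq, toPoly_eq] at hxy
  exact (SymmetricAlgebra.equivMvPolynomial B.basis).injective (h hxy)

theorem exists_toPoly_eq_iff {f : SymmetricAlgebra ℂ (Dual ℂ V)} :
    (∃ c, B.toPoly c = f) ↔ f ∈ invAlg (dualRep G) N := by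
  rw [mem_invAlg, ← B.mem_adjoin_iff, Algebra.adjoin_range_eq_range_aeval]
  constructor
  · rintro ⟨c, rfl⟩
    exact ⟨_, (B.toPoly_eq c).symm⟩
  · rintro ⟨p, rfl⟩
    exact ⟨(SymmetricAlgebra.equivMvPolynomial B.basis).symm p, by rw [toPoly_eq]; simp⟩

theorem toPoly_mem_invAlg (c : SymmetricAlgebra ℂ B.Edual) :
    B.toPoly c ∈ invAlg (dualRep G) N := B.exists_toPoly_eq_iff.1 ⟨c, rfl⟩

/-- A fundamental invariant has no constant term: otherwise it would be a constant, and constants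
are algebraic. -/
theorem algebraMapInv_inv (i : Fin (finrank ℂ V)) :
    SymmetricAlgebra.algebraMapInv (B.inv i) = 0 := by
  obtain ⟨d, hd⟩ := B.homogeneous i
  rcases Nat.eq_zero_or_pos d with rfl | hpos
  · obtain ⟨c, hc⟩ := mem_homogeneousPart_zero.1 hd
    exact absurd (hc ▸ isAlgebraic_algebraMap c) (B.algebraicIndependent.transcendental i)
  · exact algebraMapInv_eq_zero_of_mem hpos.ne' hd

theorem algebraMapInv_toPoly (c : SymmetricAlgebra ℂ B.Edual) :
    SymmetricAlgebra.algebraMapInv (B.toPoly c) = SymmetricAlgebra.algebraMapInv c := by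
  have : SymmetricAlgebra.algebraMapInv.comp B.toPoly = SymmetricAlgebra.algebraMapInv := by
    apply SymmetricAlgebra.algHom_ext
    apply B.basis.ext
    intro i
    simp [algebraMapInv_inv, SymmetricAlgebra.algebraMapInv_ι]
  exact DFunLike.congr_fun this c

/-- The action on `E*` of the scalars in `V*`; it multiplies `N_i` by a power of the scalar. -/
noncomputable def scalarRepE : Representation ℂ ℂˣ B.Edual :=
  (symRep (scalarRep (Dual ℂ V))).subrepresentation B.Edual <| by
    intro c
    rw [Edual, Submodule.span_le]
    rintro _ ⟨i, rfl⟩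
    obtain ⟨d, hd⟩ := B.homogeneous i
    change symRep (scalarRep (Dual ℂ V)) c (B.inv i) ∈ Submodule.span ℂ (Set.range B.inv)
    rw [symRep_scalarRep_of_mem c hd]
    exact Submodule.smul_mem _ _ (Submodule.subset_span ⟨i, rfl⟩)

/-- The automorphism of `S(E*)` that corresponds to the dilation of `S(V*)`. -/
noncomputable def dilationE : Module.End ℂ (SymmetricAlgebra ℂ B.Edual) := symRep B.scalarRepE two

theorem toPoly_dilationE (c : SymmetricAlgebra ℂ B.Edual) :
    B.toPoly (B.dilationE c) = dilation _ (B.toPoly c) := by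
  induction c using SymmetricAlgebra.induction with
  | algebraMap c => simp [dilationE]
  | ι x => rw [dilationE, symRep_ι, toPoly_ι, toPoly_ι]; rfl
  | mul a b ha hb => rw [dilationE, symRep_mul, map_mul, ← dilationE, ha, hb, map_mul, dilation_mul]
  | add a b ha hb => simp only [map_add, ha, hb]

variable [N.Normal]

theorem toPoly_symRep (g : G) (c : SymmetricAlgebra ℂ B.Edual) :
    B.toPoly (symRep B.repH (g : G ⧸ N) c) = symRep (dualRep G) g (B.toPoly c) := by
  induction c using SymmetricAlgebra.induction with
  | algebraMap c => simp
  | ι x => rw [symRep_ι, toPoly_ι, toPoly_ι]; rfl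
  | mul a b ha hb => rw [symRep_mul, map_mul, ha, hb, map_mul, symRep_mul]
  | add a b ha hb => simp only [map_add, ha, hb]

theorem toPoly_mem_posInv_iff {c : SymmetricAlgebra ℂ B.Edual} :
    B.toPoly c ∈ posInv (dualRep G) ⊤ ↔ c ∈ posInv B.repH ⊤ := by
  rw [mem_posInv, mem_posInv, algebraMapInv_toPoly]
  refine and_congr_left fun _ => ⟨fun h q _ => ?_, fun h g _ => ?_⟩
  · obtain ⟨g, rfl⟩ := QuotientGroup.mk_surjective q
    apply B.toPoly_injective
    rw [toPoly_symRep, h g trivial]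
  · rw [← toPoly_symRep, h g trivial]

theorem exists_toPoly_eq_of_mem_posInv {g : SymmetricAlgebra ℂ (Dual ℂ V)}
    (hg : g ∈ posInv (dualRep G) ⊤) : ∃ c ∈ posInv B.repH ⊤, B.toPoly c = g := by
  obtain ⟨c, rfl⟩ := B.exists_toPoly_eq_iff.2 fun n _ => hg.1 n trivial
  exact ⟨c, B.toPoly_mem_posInv_iff.1 hg, rfl⟩

theorem toPoly_mem_hilbertIdeal {c : SymmetricAlgebra ℂ B.Edual}
    (hc : c ∈ hilbertIdeal B.repH ⊤) : B.toPoly c ∈ hilbertIdeal (dualRep G) ⊤ := by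
  refine Submodule.mul_induction_on hc (fun a _ g hg => ?_) fun a b ha hb => ?_
  · rw [map_mul]
    exact mul_mem_hilbertIdeal_of_posInv _ (B.toPoly_mem_posInv_iff.2 hg)
  · rw [map_add]; exact Submodule.add_mem _ ha hb

/-- An `N`-invariant in the Hilbert ideal of `G` is in the Hilbert ideal of `H`, by averaging the
coefficients over `N`. -/
theorem mem_hilbertIdeal_of_toPoly [Finite G] {c : SymmetricAlgebra ℂ B.Edual}
    (hc : B.toPoly c ∈ hilbertIdeal (dualRep G) ⊤) : c ∈ hilbertIdeal B.repH ⊤ := by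
  have key : ∀ f ∈ hilbertIdeal (dualRep G) ⊤, ∃ c ∈ hilbertIdeal B.repH ⊤,
      B.toPoly c = avg (dualRep G) N f := by
    intro f hf
    refine Submodule.mul_induction_on hf (fun a _ g hg => ?_) ?_
    · obtain ⟨g', hg', rfl⟩ := B.exists_toPoly_eq_of_mem_posInv hg
      obtain ⟨a', ha'⟩ := B.exists_toPoly_eq_iff.2 fun n hn => symRep_avg (dualRep G) N hn a
      refine ⟨a' * g', mul_mem_hilbertIdeal_of_posInv _ hg', ?_⟩
      rw [map_mul, ha', avg_mul _ _ _ (B.toPoly_mem_invAlg g')]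
    · rintro x y ⟨a, ha, hax⟩ ⟨b, hb, hby⟩
      exact ⟨a + b, Submodule.add_mem _ ha hb, by rw [map_add, map_add, hax, hby]⟩
  obtain ⟨c', hc', h⟩ := key _ hc
  rw [avg_eq_self _ _ (B.toPoly_mem_invAlg c)] at h
  rwa [← B.toPoly_injective h]

theorem isCompl_CH [Finite G] : IsCompl (hilbertIdeal B.repH ⊤) B.CH :=
  isCompl_hilbertIdeal_harmonic _ _

theorem dilationE_mem_CH {c : SymmetricAlgebra ℂ B.Edual} (hc : c ∈ B.CH) :
    B.dilationE c ∈ B.CH := by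
  refine symRep_mem_harmonic_of_comm (fun q _ x => ?_) hc
  obtain ⟨g, rfl⟩ := QuotientGroup.mk_surjective q
  exact Subtype.ext (dilation_symRep (dualRep G) g (x : SymmetricAlgebra ℂ (Dual ℂ V))).symm

theorem iSup_CHdeg : ⨆ d, B.CHdeg d = ⊤ := by
  let F : B.CH →ₗ[ℂ] SymmetricAlgebra ℂ (Dual ℂ V) := B.toPoly.toLinearMap ∘ₗ B.CH.subtype
  have hF : Function.Injective F := B.toPoly_injective.comp Subtype.val_injective
  have hgr : IsGraded (LinearMap.range F) := by
    rintro _ ⟨c, rfl⟩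
    exact ⟨⟨_, B.dilationE_mem_CH c.2⟩, B.toPoly_dilationE c⟩
  have h := hgr.le_iSup
  have e : ∀ d, LinearMap.range F ⊓ homogeneousPart (Dual ℂ V) d = (B.CHdeg d).map F := fun d => by
    rw [CHdeg, Submodule.map_comap_eq]
  simp only [e, ← Submodule.map_iSup] at h
  rw [eq_top_iff]
  rintro c -
  obtain ⟨c', hc', hcc⟩ := h ⟨c, rfl⟩
  rwa [← hF hcc]

end StableInvariants

theorem iSup_Cdeg {V : Type*} [AddCommGroup V] [Module ℂ V]
    {G : Subgroup (LinearMap.GeneralLinearGroup ℂ V)} (N : Subgroup G) :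
    ⨆ d, Cdeg N d = ⊤ :=
  (isGraded_harmonic (dualRep G) N).iSup_comap_subtype

theorem tmul_mem_tensorDeg {V : Type*} [AddCommGroup V] [Module ℂ V]
    {G : Subgroup (LinearMap.GeneralLinearGroup ℂ V)} {N : Subgroup G} [N.Normal]
    (B : StableInvariants N) {i j : ℕ} {a : B.CH} (ha : a ∈ B.CHdeg i) {b : C N}
    (hb : b ∈ Cdeg N j) : a ⊗ₜ[ℂ] b ∈ tensorDeg B (i + j) :=
  Submodule.subset_span ⟨i, j, rfl, a, ha, b, hb, rfl⟩

theorem eq_top_of_tmul_mem {X Y : Type*} [AddCommGroup X] [Module ℂ X] [AddCommGroup Y]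
    [Module ℂ Y] {T : Submodule ℂ (X ⊗[ℂ] Y)} (h : ∀ a b, a ⊗ₜ[ℂ] b ∈ T) : T = ⊤ := by
  rw [eq_top_iff, ← TensorProduct.span_tmul_eq_top, Submodule.span_le]
  rintro _ ⟨a, b, rfl⟩
  exact h a b

theorem eq_top_of_tmul_mem_of_iSup_eq_top {X Y : Type*} [AddCommGroup X] [Module ℂ X]
    [AddCommGroup Y] [Module ℂ Y] {A : ℕ → Submodule ℂ X} {B : ℕ → Submodule ℂ Y}
    (hA : ⨆ i, A i = ⊤) (hB : ⨆ j, B j = ⊤) {T : Submodule ℂ (X ⊗[ℂ] Y)}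
    (h : ∀ i, ∀ a ∈ A i, ∀ j, ∀ b ∈ B j, a ⊗ₜ[ℂ] b ∈ T) : T = ⊤ := by
  have h2 : ∀ i, ∀ a ∈ A i, ∀ b, a ⊗ₜ[ℂ] b ∈ T := by
    intro i a ha b
    have hle : ⨆ j, B j ≤ T.comap (TensorProduct.mk ℂ X Y a) := iSup_le (h i a ha)
    rw [hB] at hle
    exact hle (Submodule.mem_top (x := b))
  refine eq_top_of_tmul_mem fun a b => ?_
  have hle : ⨆ i, A i ≤ T.comap ((TensorProduct.mk ℂ X Y).flip b) :=
    iSup_le fun i a ha => h2 i a ha b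
  rw [hA] at hle
  exact hle (Submodule.mem_top (x := a))

theorem exists_sum_tmul_basis {X Y κ : Type*} [AddCommGroup X] [Module ℂ X] [AddCommGroup Y]
    [Module ℂ Y] (b : Module.Basis κ ℂ Y) (t : X ⊗[ℂ] Y) :
    ∃ (s : Finset κ) (c : κ → X), t = ∑ i ∈ s, c i ⊗ₜ[ℂ] b i := by
  classical
  obtain ⟨c, rfl⟩ := (TensorProduct.equivFinsuppOfBasisRight (M := X) b).symm.surjective t
  exact ⟨c.support, c, TensorProduct.equivFinsuppOfBasisRight_symm_apply b c⟩

theorem iSup_tensorDeg {V : Type*} [AddCommGroup V] [Module ℂ V]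
    {G : Subgroup (LinearMap.GeneralLinearGroup ℂ V)} {N : Subgroup G} [N.Normal]
    (B : StableInvariants N) : ⨆ d, tensorDeg B d = ⊤ :=
  eq_top_of_tmul_mem_of_iSup_eq_top B.iSup_CHdeg (iSup_Cdeg N) fun _ _ ha _ _ hb =>
    le_iSup (tensorDeg B) _ (tmul_mem_tensorDeg B ha hb)

/-! ### The factorization of the harmonic polynomials -/

section Factorization

open Module

variable {V : Type*} [AddCommGroup V] [Module ℂ V]
  {G : Subgroup (LinearMap.GeneralLinearGroup ℂ V)}

section Projection

variable [FiniteDimensional ℂ V] [Finite G]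

variable (G) in
/-- The projection of the polynomials onto the `G`-harmonic ones along the Hilbert ideal. -/
noncomputable def harmonicProj :
    SymmetricAlgebra ℂ (Dual ℂ V) →ₗ[ℂ] C (⊤ : Subgroup G) :=
  Submodule.projectionOnto (C (⊤ : Subgroup G)) (hilbertIdeal (dualRep G) ⊤)
    (isCompl_hilbertIdeal_harmonic (dualRep G) ⊤).symm

theorem harmonicProj_eq_zero_iff {f : SymmetricAlgebra ℂ (Dual ℂ V)} :
    harmonicProj G f = 0 ↔ f ∈ hilbertIdeal (dualRep G) ⊤ :=
  Submodule.projectionOnto_apply_eq_zero_iff _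

theorem harmonicProj_coe (f : C (⊤ : Subgroup G)) :
    harmonicProj G (f : SymmetricAlgebra ℂ (Dual ℂ V)) = f :=
  Submodule.projectionOnto_apply_left _ f

theorem harmonicProj_eq_of_sub_mem {f : SymmetricAlgebra ℂ (Dual ℂ V)} {h : C (⊤ : Subgroup G)}
    (hf : f - h ∈ hilbertIdeal (dualRep G) ⊤) : harmonicProj G f = h := by
  rw [← harmonicProj_eq_zero_iff, map_sub, harmonicProj_coe, sub_eq_zero] at hf
  exact hf

theorem sub_harmonicProj_mem (f : SymmetricAlgebra ℂ (Dual ℂ V)) :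
    f - harmonicProj G f ∈ hilbertIdeal (dualRep G) ⊤ := by
  rw [← harmonicProj_eq_zero_iff, map_sub, harmonicProj_coe, sub_self]

theorem harmonicProj_symRep (g : G) (f : SymmetricAlgebra ℂ (Dual ℂ V)) :
    harmonicProj G (symRep (dualRep G) g f) = repC ⊤ g (harmonicProj G f) := by
  apply harmonicProj_eq_of_sub_mem
  have := symRep_mem_hilbertIdeal g (sub_harmonicProj_mem f)
  rwa [map_sub] at this

theorem coe_harmonicProj_dilation (f : SymmetricAlgebra ℂ (Dual ℂ V)) :
    (harmonicProj G (dilation _ f) : SymmetricAlgebra ℂ (Dual ℂ V)) =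
      dilation _ (harmonicProj G f : SymmetricAlgebra ℂ (Dual ℂ V)) := by
  have h := isGraded_hilbertIdeal _ _ _ (sub_harmonicProj_mem (G := G) f)
  rw [map_sub] at h
  exact congrArg Subtype.val (harmonicProj_eq_of_sub_mem
    (h := ⟨_, isGraded_harmonic _ _ _ (harmonicProj G f).2⟩) h)

theorem harmonicProj_mem_Cdeg {d : ℕ} {f : SymmetricAlgebra ℂ (Dual ℂ V)}
    (hf : f ∈ homogeneousPart (Dual ℂ V) d) : harmonicProj G f ∈ Cdeg ⊤ d := by
  change (harmonicProj G f : SymmetricAlgebra ℂ (Dual ℂ V)) ∈ homogeneousPart (Dual ℂ V) d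
  rw [mem_homogeneousPart_iff, ← coe_harmonicProj_dilation, mem_homogeneousPart_iff.1 hf,
    map_smul]
  rfl

end Projection

variable {N : Subgroup G} [N.Normal] (B : StableInvariants N)

/-- The multiplication `C_H ⊗ C_N → S(V*)`. -/
noncomputable def harmonicMul : B.CH ⊗[ℂ] C N →ₗ[ℂ] SymmetricAlgebra ℂ (Dual ℂ V) :=
  TensorProduct.lift ((LinearMap.mul ℂ (SymmetricAlgebra ℂ (Dual ℂ V))).compl₁₂
    (B.toPoly.toLinearMap ∘ₗ B.CH.subtype) (C N).subtype)

@[simp] theorem harmonicMul_tmul (c : B.CH) (b : C N) :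
    harmonicMul B (c ⊗ₜ b) = B.toPoly c * (b : SymmetricAlgebra ℂ (Dual ℂ V)) := rfl

theorem harmonicMul_equivariant (g : G) (t : B.CH ⊗[ℂ] C N) :
    harmonicMul B (Representation.tprod (B.repCH.comp (QuotientGroup.mk' N)) (repC N) g t) =
      symRep (dualRep G) g (harmonicMul B t) := by
  refine LinearMap.congr_fun (TensorProduct.ext'
    (g := harmonicMul B ∘ₗ Representation.tprod (B.repCH.comp (QuotientGroup.mk' N)) (repC N) g)
    (h := symRep (dualRep G) g ∘ₗ harmonicMul B) fun c b => ?_) t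
  change B.toPoly (symRep B.repH (g : G ⧸ N) c) * symRep (dualRep G) g b =
    symRep (dualRep G) g (B.toPoly c * b)
  rw [symRep_mul, ← B.toPoly_symRep]

theorem harmonicMul_mem_homogeneousPart {d : ℕ} {t : B.CH ⊗[ℂ] C N} (ht : t ∈ tensorDeg B d) :
    harmonicMul B t ∈ homogeneousPart (Dual ℂ V) d := by
  suffices h : tensorDeg B d ≤ (homogeneousPart (Dual ℂ V) d).comap (harmonicMul B) from h ht
  refine Submodule.span_le.2 ?_
  rintro _ ⟨i, j, rfl, a, ha, b, hb, rfl⟩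
  exact mul_mem_homogeneousPart ha hb

variable [Finite G]

theorem harmonicMul_mul_toPoly_mem (t : B.CH ⊗[ℂ] C N) (g : SymmetricAlgebra ℂ B.Edual) :
    harmonicMul B t * B.toPoly g ∈
      LinearMap.range (harmonicMul B) ⊔ hilbertIdeal (dualRep G) ⊤ := by
  have htop : (LinearMap.range (harmonicMul B) ⊔ hilbertIdeal (dualRep G) ⊤).comap
      (LinearMap.mulRight ℂ (B.toPoly g) ∘ₗ harmonicMul B) = ⊤ := by
    refine eq_top_of_tmul_mem fun c b => ?_
    change B.toPoly c * b * B.toPoly g ∈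
      LinearMap.range (harmonicMul B) ⊔ hilbertIdeal (dualRep G) ⊤
    -- The `N`-invariant `c * g` is replaced by its `H`-harmonic part modulo the Hilbert ideal.
    have hcg : (c : SymmetricAlgebra ℂ B.Edual) * g ∈ hilbertIdeal B.repH ⊤ ⊔ B.CH := by
      rw [B.isCompl_CH.sup_eq_top]
      exact Submodule.mem_top
    obtain ⟨j, hj, h, hh, e⟩ := Submodule.mem_sup.1 hcg
    rw [mul_right_comm, ← map_mul, ← e, map_add, add_mul, mul_comm (B.toPoly j)]
    exact Submodule.add_mem _
      (Submodule.mem_sup_right (mul_mem_hilbertIdeal _ (B.toPoly_mem_hilbertIdeal hj)))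
      (Submodule.mem_sup_left ⟨⟨h, hh⟩ ⊗ₜ b, rfl⟩)
  exact Submodule.eq_top_iff'.1 htop t

variable [FiniteDimensional ℂ V]

/-- The products of `H`- and `N`-harmonic polynomials span `S(V*)` modulo the Hilbert ideal. -/
theorem range_harmonicMul_sup_hilbertIdeal :
    LinearMap.range (harmonicMul B) ⊔ hilbertIdeal (dualRep G) ⊤ = ⊤ := by
  refine eq_top_of_harmonic_le (ρ := dualRep G) (N := N) (fun b hb => ?_) fun a ha g hg => ?_
  · refine Submodule.mem_sup_left ⟨⟨1, one_mem_harmonic _ _⟩ ⊗ₜ ⟨b, hb⟩, ?_⟩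
    rw [harmonicMul_tmul, map_one, one_mul]
  · obtain ⟨_, ⟨t, rfl⟩, i, hi, rfl⟩ := Submodule.mem_sup.1 ha
    obtain ⟨g, rfl⟩ := B.exists_toPoly_eq_iff.2 hg.1
    rw [add_mul, mul_comm i]
    exact Submodule.add_mem _ (harmonicMul_mul_toPoly_mem B t g)
      (Submodule.mem_sup_right (mul_mem_hilbertIdeal _ hi))

theorem eq_zero_of_harmonicMul_mem (hN : IsReflectionGroup (N.map G.subtype))
    {t : B.CH ⊗[ℂ] C N} (ht : harmonicMul B t ∈ hilbertIdeal (dualRep G) ⊤) : t = 0 := by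
  classical
  obtain ⟨n, b, hb⟩ := exists_homogeneous_basis (isGraded_harmonic (dualRep G) N)
  obtain ⟨s, c, rfl⟩ := exists_sum_tmul_basis b t
  rw [map_sum] at ht
  have key := coeff_mem_hilbertIdeal (closure_fixesHyperplane hN) (le_top : N ≤ ⊤) hb s
    (c := fun i => B.toPoly (c i)) (fun i => B.toPoly_mem_invAlg _) ht
  refine Finset.sum_eq_zero fun i hi => ?_
  have h0 := B.isCompl_CH.disjoint.le_bot ⟨B.mem_hilbertIdeal_of_toPoly (key i hi), (c i).2⟩
  have h1 : c i = 0 := Subtype.ext ((Submodule.mem_bot ℂ).1 h0)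
  rw [h1, TensorProduct.zero_tmul]

theorem bijective_harmonicProj_harmonicMul (hN : IsReflectionGroup (N.map G.subtype)) :
    Function.Bijective (harmonicProj G ∘ₗ harmonicMul B) := by
  constructor
  · rw [injective_iff_map_eq_zero]
    intro t ht
    exact eq_zero_of_harmonicMul_mem B hN (harmonicProj_eq_zero_iff.1 ht)
  · intro f
    obtain ⟨_, ⟨t, rfl⟩, i, hi, e⟩ := Submodule.mem_sup.1
      (range_harmonicMul_sup_hilbertIdeal B ▸ Submodule.mem_top :
        (f : SymmetricAlgebra ℂ (Dual ℂ V)) ∈ _)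
    refine ⟨t, harmonicProj_eq_of_sub_mem ?_⟩
    rw [← e, sub_add_cancel_left]
    exact Submodule.neg_mem _ hi

/-- The isomorphism of `G`-modules `C_H ⊗ C_N ≃ C_G`: multiply, then project onto the harmonic
polynomials. -/
noncomputable def harmonicEquiv (hN : IsReflectionGroup (N.map G.subtype)) :
    Representation.Equiv (Representation.tprod (B.repCH.comp (QuotientGroup.mk' N)) (repC N))
      (repC (⊤ : Subgroup G)) :=
  .mk (.ofBijective _ (bijective_harmonicProj_harmonicMul B hN)) fun g => by
    refine LinearMap.ext fun t => ?_
    change harmonicProj G (harmonicMul B _) = repC ⊤ g (harmonicProj G (harmonicMul B t))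
    rw [harmonicMul_equivariant, harmonicProj_symRep]

theorem harmonicEquiv_apply (hN : IsReflectionGroup (N.map G.subtype)) (t : B.CH ⊗[ℂ] C N) :
    harmonicEquiv B hN t = harmonicProj G (harmonicMul B t) := rfl

theorem map_tensorDeg_harmonicEquiv (hN : IsReflectionGroup (N.map G.subtype)) (d : ℕ) :
    (tensorDeg B d).map (harmonicEquiv B hN).toLinearEquiv.toLinearMap = Cdeg ⊤ d := by
  let Φ : B.CH ⊗[ℂ] C N →ₗ[ℂ] C (⊤ : Subgroup G) := harmonicProj G ∘ₗ harmonicMul B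
  change (tensorDeg B d).map Φ = Cdeg ⊤ d
  have hle : ∀ k, (tensorDeg B k).map Φ ≤ Cdeg ⊤ k := by
    rintro k _ ⟨t, ht, rfl⟩
    exact harmonicProj_mem_Cdeg (harmonicMul_mem_homogeneousPart B ht)
  refine le_antisymm (hle d) fun f hf => ?_
  -- The images of the graded parts span `C_G`, so that the element `f` of degree `d` is in the
  -- image of the part of degree `d`.
  have hsup : ⨆ k, ((tensorDeg B k).map Φ).map (C (⊤ : Subgroup G)).subtype =
      C (⊤ : Subgroup G) := by
    rw [← Submodule.map_iSup, ← Submodule.map_iSup, iSup_tensorDeg, Submodule.map_top,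
      LinearMap.range_eq_top.2 (bijective_harmonicProj_harmonicMul B hN).2, Submodule.map_top,
      Submodule.range_subtype]
  obtain ⟨f', hf', e⟩ := mem_of_mem_iSup_of_mem_homogeneousPart
    (Y := fun k => ((tensorDeg B k).map Φ).map (C (⊤ : Subgroup G)).subtype)
    (fun k => by rintro _ ⟨x, hx, rfl⟩; exact hle k hx) (hsup.ge f.2) hf
  rwa [← Subtype.ext e]

/-! ### The `N`-invariant harmonic polynomials -/

/-- The map `c ↦ φ(c ⊗ 1)`. -/
noncomputable def harmonicIncl : B.CH →ₗ[ℂ] C (⊤ : Subgroup G) :=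
  harmonicProj G ∘ₗ B.toPoly.toLinearMap ∘ₗ B.CH.subtype

theorem harmonicIncl_apply (c : B.CH) : harmonicIncl B c = harmonicProj G (B.toPoly c) := rfl

theorem harmonicEquiv_tmul_one (hN : IsReflectionGroup (N.map G.subtype)) (c : B.CH) :
    harmonicEquiv B hN (c ⊗ₜ[ℂ] ⟨1, one_mem_harmonic (dualRep G) N⟩) = harmonicIncl B c := by
  rw [harmonicEquiv_apply, harmonicMul_tmul, mul_one, harmonicIncl_apply]

theorem harmonicIncl_injective : Function.Injective (harmonicIncl B) := by
  rw [injective_iff_map_eq_zero]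
  intro c hc
  rw [harmonicIncl_apply, harmonicProj_eq_zero_iff] at hc
  have := B.isCompl_CH.disjoint.le_bot ⟨B.mem_hilbertIdeal_of_toPoly hc, c.2⟩
  exact Subtype.ext ((Submodule.mem_bot ℂ).1 this)

theorem repC_harmonicIncl (g : G) (c : B.CH) :
    repC ⊤ g (harmonicIncl B c) = harmonicIncl B (B.repCH (g : G ⧸ N) c) :=
  (harmonicProj_symRep g _).symm.trans (congrArg (harmonicProj G) (B.toPoly_symRep g c).symm)

theorem harmonicIncl_mem_invariants (c : B.CH) :
    harmonicIncl B c ∈ Representation.invariants ((repC (⊤ : Subgroup G)).comp N.subtype) := by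
  intro n
  change repC ⊤ (n : G) (harmonicIncl B c) = _
  rw [repC_harmonicIncl, (QuotientGroup.eq_one_iff (n : G)).2 n.2, map_one,
    Module.End.one_apply]

theorem exists_harmonicIncl_eq {f : C (⊤ : Subgroup G)}
    (hf : f ∈ Representation.invariants ((repC (⊤ : Subgroup G)).comp N.subtype)) :
    ∃ c, harmonicIncl B c = f := by
  obtain ⟨c, hc⟩ := B.exists_toPoly_eq_iff.2
    fun n hn => congrArg Subtype.val (hf ⟨n, hn⟩)
  obtain ⟨i, hi, h, hh, e⟩ := Submodule.mem_sup.1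
    (B.isCompl_CH.sup_eq_top ▸ Submodule.mem_top : c ∈ _)
  refine ⟨⟨h, hh⟩, harmonicProj_eq_of_sub_mem ?_⟩
  change B.toPoly h - (C (⊤ : Subgroup G)).subtype f ∈ _
  rw [← hc, ← e, map_add, sub_add_cancel_right]
  exact Submodule.neg_mem _ (B.toPoly_mem_hilbertIdeal hi)

theorem mem_CHdeg_iff (d : ℕ) (c : B.CH) : c ∈ B.CHdeg d ↔ harmonicIncl B c ∈ Cdeg ⊤ d := by
  refine ⟨fun hc => harmonicProj_mem_Cdeg hc, fun hc => ?_⟩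
  change B.toPoly c ∈ homogeneousPart (Dual ℂ V) d
  have h : harmonicIncl B ⟨_, B.dilationE_mem_CH c.2⟩ = harmonicIncl B ((2 : ℂ) ^ d • c) := by
    apply Subtype.ext
    rw [map_smul, harmonicIncl_apply, B.toPoly_dilationE, coe_harmonicProj_dilation]
    exact mem_homogeneousPart_iff.1 hc
  have e := congrArg (fun c : B.CH => B.toPoly c) (harmonicIncl_injective B h)
  rw [mem_homogeneousPart_iff, ← B.toPoly_dilationE]
  exact e.trans (map_smul B.toPoly _ _)

/-- The linear isomorphism from `C_H` onto the `N`-invariants of `C_G`. -/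
noncomputable def harmonicInclLinearEquiv :
    B.CH ≃ₗ[ℂ] Representation.invariants ((repC (⊤ : Subgroup G)).comp N.subtype) :=
  .ofBijective ((harmonicIncl B).codRestrict _ (harmonicIncl_mem_invariants B))
    ⟨fun _ _ h => harmonicIncl_injective B (congrArg Subtype.val h), fun f =>
      (exists_harmonicIncl_eq B f.2).imp fun _ h => Subtype.ext h⟩

/-- The isomorphism of `H`-modules from `C_H` onto the `N`-invariants of `C_G`. -/
noncomputable def harmonicInclEquiv :
    Representation.Equiv B.repCH ((repC (⊤ : Subgroup G)).quotientToInvariants N) :=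
  .mk (harmonicInclLinearEquiv B) fun q => by
    obtain ⟨g, rfl⟩ := QuotientGroup.mk_surjective q
    refine LinearMap.ext fun c => Subtype.ext ?_
    exact (repC_harmonicIncl B g c).symm

end Factorization

end HarmonicPoly

theorem mainTheorem3 {V : Type*} [AddCommGroup V] [Module ℂ V] [FiniteDimensional ℂ V]
    (G : Subgroup (LinearMap.GeneralLinearGroup ℂ V)) (hG : IsReflectionGroup G)
    (N : Subgroup G) [N.Normal] (hN : IsReflectionGroup (N.map G.subtype)) :
    Nonempty (StableInvariants N) ∧
    ∀ B : StableInvariants N,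
      ∃ φ : Representation.Equiv
          (Representation.tprod (B.repCH.comp (QuotientGroup.mk' N)) (repC N))
          (repC (⊤ : Subgroup G)),
        (∀ d : ℕ, (tensorDeg B d).map φ.toLinearEquiv.toLinearMap = Cdeg (⊤ : Subgroup G) d) ∧
        ∃ ψ : Representation.Equiv B.repCH ((repC (⊤ : Subgroup G)).quotientToInvariants N),
          (∀ (d : ℕ) (c : B.CH), c ∈ B.CHdeg d ↔ (ψ c).1 ∈ Cdeg (⊤ : Subgroup G) d) ∧
          ∀ c : B.CH, (ψ c).1 = φ (c ⊗ₜ[ℂ] ⟨1, one_mem_harmonic (dualRep G) N⟩) := by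
  have := hG.1
  exact ⟨nonempty_stableInvariants N hN, fun B => ⟨harmonicEquiv B hN,
    map_tensorDeg_harmonicEquiv B hN, harmonicInclEquiv B, mem_CHdeg_iff B,
    fun c => (harmonicEquiv_tmul_one B hN c).symm⟩⟩
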